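/- Let $m\ge 0$, $0=\theta_0<\theta_1<\dots<\theta_m<\theta_{m+1}=\pi$, and let $\Omega=[0,\pi]\setminus\{\theta_1,\dots,\theta_m\}=\Omega_0\cup\dots\cup\Omega_m$, where $\Omega_i$ is the part of $\Omega$ between $\theta_i$ and $\theta_{i+1}$. Consider the boundary value problem $$y''(t)+q(t)\,y(t-\Delta(t))+\mu^2y(t)=0,\qquad t\in\Omega,$$ $$\alpha_1^-y(0)-\alpha_2^-y'(0)+\mu\big(\alpha_1^+y(0)-\alpha_2^+y'(0)\big)=0,$$ $$\beta_1^-y(\pi)-\beta_2^-y'(\pi)+\mu\big(\beta_1^+y(\pi)-\beta_2^+y'(\pi)\big)=0,$$ $$y(\theta_i-)=\delta_i\,y(\theta_i+),\qquad y'(\theta_i-)=\delta_i\,y'(\theta_i+)\qquad(i=1,\dots,m),$$ where $\mu$ is a complex spectral parameter; $\alpha_j^\pm,\beta_j^\pm$ and $\delta_i\neq0$ are real numbers with $\alpha_2^+\beta_2^+\ne0$; $q$ and $\Delta\ge0$ are real-valued and continuous on $\Omega$ with finite one-sided limits at each $\theta_i$ $(1\le i\le m)$; and $t-\Delta(t)\ge\theta_i$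 for $t\in\Omega_i$ $(i=0,\dots,m)$. (A solution is understood on each $\Omega_i$ as extended by its limits to $[\theta_i,\theta_{i+1}]$, where it is $C^1$.) For every $\mu\in\mathbb C$ there is a unique solution $\varphi(\cdot,\mu)$ of the differential equation and the transmission conditions with $\varphi(0,\mu)=\mu\alpha_2^++\alpha_2^-$ and $\varphi'(0,\mu)=\mu\alpha_1^++\alpha_1^-$, and the characteristic function $$\Xi(\mu)=(\mu\beta_1^++\beta_1^-)\,\varphi(\pi,\mu)-(\mu\beta_2^++\beta_2^-)\,\varphi'(\pi,\mu)$$ is entire. Index by $n\in\{\pm0,\pm1,\pm2,\dots\}$ (with $+0$ and $-0$ two different indices), and put $\mu^0_{\pm0}=0$, $\mu_n^0=n-1$ for $n\ge1$ and $\mu_n^0=n+1$ for $n\le-1$; these numbers are the zeros, counted with multiplicity, of $$\Xi_0(\mu)=\frac{\mu^3\alpha_2^+\beta_2^+}{\prod_{i=1}^m\delta_i}\sin\mu\pi .$$ Then the zeros of $\Xi$, counted with multiplicity, can be indexed as $\mu_n$, $n\in\{\pm0,\pm1,\pm2,\dots\}$, in such a way that, as $|n|\to\infty$, $$\mu_n=\mu_n^0-\frac{1}{\mu_n^0\pi}\left(\frac{\beta_1^+}{\beta_2^+}-\frac{\alpha_1^+}{\alpha_2^+}+U^+(\mu_n^0)+V^+(\mu_n^0)\right)+O\!\left(\frac1{(\mu_n^0)^2}\right),$$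 where $$U^+(\mu)=\frac12\int_0^\pi q(\tau)\cos\big(\mu\Delta(\tau)\big)\,d\tau,\qquad V^+(\mu)=\frac12\int_0^\pi q(\tau)\cos\big(\mu(2\tau-\Delta(\tau))\big)\,d\tau .$$ Moreover, the set of the numbers $\mu_n$ is exactly the set of those $\mu\in\mathbb C$ for which the boundary value problem has a nontrivial solution. -/

import Mathlib

open Real Set Filter Topology Asymptotics

/-- The data of the retarded Sturm–Liouville problem with `m` transmission points
`0 = θ 0 < θ 1 < ... < θ m < θ (m + 1) = π`, together with the standing assumptions on them.
Here `δ j` belongs to the transmission point `θ (j + 1)`, and `α₁p, α₁m` stand for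
`α₁⁺, α₁⁻`, and so on. The values of `q` and `Δ` outside `Ω` play no role. -/
structure RetardedSL (m : ℕ) where
  θ : Fin (m + 2) → ℝ
  δ : Fin m → ℝ
  q : ℝ → ℝ
  Δ : ℝ → ℝ
  (α₁p α₁m α₂p α₂m β₁p β₁m β₂p β₂m : ℝ)
  θ_strictMono : StrictMono θ
  θ_zero : θ 0 = 0
  θ_last : θ (Fin.last (m + 1)) = π
  δ_ne_zero : ∀ j, δ j ≠ 0
  α₂p_mul_β₂p_ne_zero : α₂p * β₂p ≠ 0
  q_continuousOn : ContinuousOn q (Icc 0 π \ range fun j : Fin m => θ j.castSucc.succ)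
  q_left_limit : ∀ j : Fin m, ∃ l, Tendsto q (𝓝[<] θ j.castSucc.succ) (𝓝 l)
  q_right_limit : ∀ j : Fin m, ∃ l, Tendsto q (𝓝[>] θ j.castSucc.succ) (𝓝 l)
  Δ_continuousOn : ContinuousOn Δ (Icc 0 π \ range fun j : Fin m => θ j.castSucc.succ)
  Δ_left_limit : ∀ j : Fin m, ∃ l, Tendsto Δ (𝓝[<] θ j.castSucc.succ) (𝓝 l)
  Δ_right_limit : ∀ j : Fin m, ∃ l, Tendsto Δ (𝓝[>] θ j.castSucc.succ) (𝓝 l)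
  Δ_nonneg : ∀ t ∈ Icc 0 π \ range (fun j : Fin m => θ j.castSucc.succ), 0 ≤ Δ t
  /-- On each of the intervals that make up `Ω` the retarded argument does not leave
  (the closure of) that interval. -/
  le_sub_Δ : ∀ i : Fin (m + 1), ∀ t ∈ Icc (θ i.castSucc) (θ i.succ) \
    range (fun j : Fin m => θ j.castSucc.succ), θ i.castSucc ≤ t - Δ t

namespace RetardedSL

variable {m : ℕ} (P : RetardedSL m)

/-- The `i`-th closed interval `[θ i, θ (i + 1)]`, for `i = 0, ..., m`. -/
def closedPiece (i : Fin (m + 1)) : Set ℝ := Icc (P.θ i.castSucc) (P.θ i.succ)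

/-- The `i`-th interval `Ω i` of `Ω`: the transmission points are removed, while `0` and `π`
belong to the first and to the last interval. -/
def piece (i : Fin (m + 1)) : Set ℝ :=
  P.closedPiece i \ range fun j : Fin m => P.θ j.castSucc.succ

/-- `y i`, with derivative `dy i`, is for every `i` a solution on `Ω i` of
`y'' (t) + q t * y (t - Δ t) + μ ^ 2 * y t = 0` which is `C¹` up to the endpoints of `Ω i`,
and the transmission conditions `y (θ -) = δ * y (θ +)`, `y' (θ -) = δ * y' (θ +)` hold.
Thus `y i` is the restriction of the solution to `Ω i`, extended by its limits to the closed
interval. Derivatives at endpoints are one-sided. -/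
structure IsSolution (μ : ℂ) (y dy : Fin (m + 1) → ℝ → ℂ) : Prop where
  hasDeriv : ∀ i, ∀ t ∈ P.closedPiece i, HasDerivWithinAt (y i) (dy i t) (P.closedPiece i) t
  continuousOn_deriv : ∀ i, ContinuousOn (dy i) (P.closedPiece i)
  equation : ∀ i, ∀ t ∈ P.piece i, HasDerivWithinAt (dy i)
    (-((P.q t : ℂ) * y i (t - P.Δ t)) - μ ^ 2 * y i t) (P.closedPiece i) t
  transmission : ∀ j : Fin m,
    y j.castSucc (P.θ j.castSucc.succ) - P.δ j * y j.succ (P.θ j.castSucc.succ) = 0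
  transmission_deriv : ∀ j : Fin m,
    dy j.castSucc (P.θ j.castSucc.succ) - P.δ j * dy j.succ (P.θ j.castSucc.succ) = 0

/-- `μ` is in the spectrum: the boundary value problem has a nontrivial solution. -/
def IsSpectral (μ : ℂ) : Prop :=
  ∃ y dy : Fin (m + 1) → ℝ → ℂ, P.IsSolution μ y dy ∧
    (P.α₁m * y 0 0 - P.α₂m * dy 0 0 + μ * (P.α₁p * y 0 0 - P.α₂p * dy 0 0) = 0) ∧
    (P.β₁m * y (Fin.last m) π - P.β₂m * dy (Fin.last m) π
      + μ * (P.β₁p * y (Fin.last m) π - P.β₂p * dy (Fin.last m) π) = 0) ∧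
    ∃ i, ∃ t ∈ P.closedPiece i, y i t ≠ 0

/-- `φ`, with derivative `dφ`, is the solution `φ (·, μ)` with initial values
`φ 0 = μ α₂⁺ + α₂⁻`, `φ' 0 = μ α₁⁺ + α₁⁻`, continued through the transmission conditions. -/
structure IsPhi (μ : ℂ) (φ dφ : Fin (m + 1) → ℝ → ℂ) : Prop where
  isSolution : P.IsSolution μ φ dφ
  initial : φ 0 0 = μ * P.α₂p + P.α₂m
  initial_deriv : dφ 0 0 = μ * P.α₁p + P.α₁m

open Classical in
/-- The characteristic function
`Ξ μ = (μ β₁⁺ + β₁⁻) φ (π, μ) - (μ β₂⁺ + β₂⁻) φ' (π, μ)`.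
The solution `φ (·, μ)` exists and is unique, so that the second branch never occurs. -/
noncomputable def Xi (μ : ℂ) : ℂ :=
  if h : ∃ Y : (Fin (m + 1) → ℝ → ℂ) × (Fin (m + 1) → ℝ → ℂ), P.IsPhi μ Y.1 Y.2 then
    (μ * P.β₁p + P.β₁m) * h.choose.1 (Fin.last m) π
      - (μ * P.β₂p + P.β₂m) * h.choose.2 (Fin.last m) π
  else 0

/-- `Ξ₀ μ = (α₂⁺ β₂⁺ / ∏ δ) μ ^ 3 sin (μ π)`. -/
noncomputable def Xi₀ (μ : ℂ) : ℂ :=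
  μ ^ 3 * (P.α₂p * P.β₂p) / (∏ j, (P.δ j : ℂ)) * Complex.sin (μ * π)

/-- `U⁺ x = (1 / 2) ∫ τ in 0..π, q τ * cos (x * Δ τ)`. -/
noncomputable def Uplus (x : ℝ) : ℝ :=
  1 / 2 * ∫ τ in (0 : ℝ)..π, P.q τ * cos (x * P.Δ τ)

/-- `V⁺ x = (1 / 2) ∫ τ in 0..π, q τ * cos (x * (2 * τ - Δ τ))`. -/
noncomputable def Vplus (x : ℝ) : ℝ :=
  1 / 2 * ∫ τ in (0 : ℝ)..π, P.q τ * cos (x * (2 * τ - P.Δ τ))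

end RetardedSL

/-- The numbers `μₙ⁰`, indexed by `n = ±0, ±1, ±2, ...`; the index `±n` is the pair
`(±1, n)`. So `μ₋₀⁰ = μ₊₀⁰ = μ₋₁⁰ = μ₊₁⁰ = 0`, and `μₙ⁰ = n - 1` for `n ≥ 1`,
`μₙ⁰ = n + 1` for `n ≤ -1` (the subtraction below is that of `ℕ`). -/
def muZero (k : ℤˣ × ℕ) : ℝ := ((k.1 : ℤ) : ℝ) * ((k.2 - 1 : ℕ) : ℝ)

/-! ### Zeros of entire functions in discs -/

/-! Multiplying the solution on the `i`-th interval by the product of the first `i` transmission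
coefficients removes the jumps: the equation is linear, and the retarded argument stays in the
interval of `t`, so the factor cancels. What remains is one retarded equation `y'' + w * y ∘ σ + μ ^
2 * y = 0` on `[0, π]` whose coefficients may be discontinuous on a finite set, and `Xi` is its
characteristic function divided by the product of all `δ j` (`RetardedSL.exists_Xi_eq`). Twice
integrated, this equation reads `(1 + V) y = a + b t` with a Volterra operator `V`. Powers of `V`
decay factorially, so `1 + V` is invertible; it is polynomial in `μ`, so solutions with entire
initial values are entire in `μ`, and hence so is `Xi`.

For large `μ`, variation of constants bounds `y` by a multiple of `|μ| exp (|Im μ| t)` and gives `y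
t = μ α₂⁺ cos (μ t) + O(exp (|Im μ| t))`. Inserting this in the formula for `y' π` yields
(`IsRetardedKernel.exists_expansion`) `Xi μ * ∏ δ = α₂⁺ β₂⁺ μ ^ 3 sin (μ π) + μ ^ 2 H μ + O(|μ| exp
(π |Im μ|))`, where `H` is bounded by a multiple of `exp (π |Im μ|)`, is Lipschitz in the strip `|Im
μ| ≤ 1`, and contains the integral of `w τ * cos (μ σ τ) * cos (μ (π - τ))`.

Away from the integers `|sin (π z)|` is at least `exp (π |Im z|) / 8`, so the cubic term dominates
at large `z`. Rouché's theorem on the circle `|z| = N + 1/2` and on circles of radius `1/4` about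
large integers matches the zeros of `Xi` with those of `Xi₀` (`exists_enumeration_of_zeros`).

Near a large integer `n`, solving the equation for the sine first gives `z - n = O(1 / n)`. A second
pass, linearising the sine and replacing `H z / z` by `H n / n`, costs only `O(1 / n ^ 2)`
(`exists_norm_sub_le_of_zero`). Since `H` is evaluated exactly at `n`, Lipschitz continuity suffices
and no smoothness of `q` or `Δ` enters. There `(-1) ^ n cos (n (π - τ)) = cos (n τ)`, and the
product formula for cosines turns the integral into `U⁺ + V⁺`
(`RetardedSL.retardedCosIntegral_int`). The identification with the spectrum is
`RetardedSL.isSpectral_iff`. -/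

theorem Differentiable.analyticOrderAt_ne_top {f : ℂ → ℂ} (hf : Differentiable ℂ f)
    (h : ∃ z, f z ≠ 0) (a : ℂ) : analyticOrderAt f a ≠ ⊤ := by
  intro ha
  obtain ⟨z, hz⟩ := h
  have hA : AnalyticOnNhd ℂ f univ := fun x _ => hf.analyticAt x
  exact hz (hA.eqOn_zero_of_preconnected_of_eventuallyEq_zero isPreconnected_univ (mem_univ a)
    (analyticOrderAt_eq_top.1 ha) (mem_univ z))

/-- By removable singularities `dslope f a` is again entire, and dividing by `z - a` lowers the
order at `a` by one. -/
theorem Differentiable.exists_eq_pow_mul {n : ℕ} (a : ℂ) {f : ℂ → ℂ} (hf : Differentiable ℂ f)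
    (h : analyticOrderAt f a = n) :
    ∃ g : ℂ → ℂ, Differentiable ℂ g ∧ g a ≠ 0 ∧ ∀ z, f z = (z - a) ^ n * g z := by
  induction n generalizing f with
  | zero =>
    refine ⟨f, hf, ?_, fun z => by simp⟩
    exact (hf.analyticAt a).analyticOrderAt_eq_zero.1 (by simpa using h)
  | succ n ih =>
    have h0 : f a = 0 := (hf.analyticAt a).analyticOrderAt_ne_zero.1 (by rw [h]; simp)
    have hd : Differentiable ℂ (dslope f a) := by
      rw [← differentiableOn_univ, Complex.differentiableOn_dslope univ_mem]
      exact hf.differentiableOn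
    have hfd : f = (fun z => z - a) * dslope f a := by
      ext z
      have := sub_smul_dslope f a z
      simp only [smul_eq_mul, h0, sub_zero] at this
      simp [this]
    have ho : analyticOrderAt (dslope f a) a = n := by
      have h1 : analyticOrderAt f a = 1 + analyticOrderAt (dslope f a) a := by
        conv_lhs => rw [hfd]
        rw [analyticOrderAt_mul (by fun_prop) (hd.analyticAt a), analyticOrderAt_id_sub_const_self]
      rw [h, add_comm, Nat.cast_add, Nat.cast_one] at h1
      exact (WithTop.add_left_cancel ENat.one_ne_top h1).symm
    obtain ⟨g, hg, hga, hgz⟩ := ih hd ho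
    refine ⟨g, hg, hga, fun z => ?_⟩
    rw [hfd, Pi.mul_apply, hgz]
    ring

/-- The zeros are split off one point of `Z` at a time. Each new cofactor divides the previous one,
so it stays nonzero at the points already treated. -/
theorem Differentiable.exists_eq_multiset_prod_mul (Z : Finset ℂ) {f : ℂ → ℂ}
    (hf : Differentiable ℂ f) (h : ∃ z, f z ≠ 0) :
    ∃ (s : Multiset ℂ) (g : ℂ → ℂ), (∀ a ∈ s, a ∈ Z) ∧ Differentiable ℂ g ∧
      (∀ a ∈ Z, g a ≠ 0) ∧ ∀ z, f z = (s.map fun a => z - a).prod * g z := by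
  induction Z using Finset.induction_on with
  | empty => exact ⟨0, f, by simp, hf, by simp, by simp⟩
  | insert a Z ha ih =>
    obtain ⟨s, g, hs, hg, hgZ, hfg⟩ := ih
    have hg0 : ∃ z, g z ≠ 0 := by
      obtain ⟨z, hz⟩ := h
      exact ⟨z, fun h0 => hz (by rw [hfg, h0, mul_zero])⟩
    obtain ⟨n, hn⟩ := ENat.ne_top_iff_exists.1 (hg.analyticOrderAt_ne_top hg0 a)
    obtain ⟨k, hk, hka, hkz⟩ := hg.exists_eq_pow_mul a hn.symm
    refine ⟨s + Multiset.replicate n a, k, ?_, hk, ?_, fun z => ?_⟩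
    · intro b hb
      rcases Multiset.mem_add.1 hb with hb | hb
      · exact Finset.mem_insert_of_mem (hs b hb)
      · rw [Multiset.eq_of_mem_replicate hb]
        exact Finset.mem_insert_self a Z
    · intro b hb
      rcases Finset.mem_insert.1 hb with rfl | hb
      · exact hka
      · intro h0
        exact hgZ b hb (by rw [hkz, h0, mul_zero])
    · rw [hfg, hkz]
      simp [mul_assoc]

theorem Differentiable.finite_zeros_inter_isCompact {f : ℂ → ℂ} (hf : Differentiable ℂ f)
    (h : ∃ z, f z ≠ 0) {K : Set ℂ} (hK : IsCompact K) : (K ∩ {z | f z = 0}).Finite := by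
  by_contra hinf
  obtain ⟨a, -, ha⟩ := Set.Infinite.exists_accPt_of_subset_isCompact hinf hK inter_subset_left
  have hfr : ∃ᶠ z in 𝓝[≠] a, f z = 0 :=
    (accPt_iff_frequently_nhdsNE.1 ha).mono fun z hz => hz.2
  exact hf.analyticOrderAt_ne_top h a (analyticOrderAt_eq_top.2
    ((hf.analyticAt a).frequently_zero_iff_eventually_zero.1 hfr))

/-- An entire function without zeros on the boundary of a disc is a monic polynomial with zeros in
the disc, times an entire function without zeros in the closed disc. -/
theorem Differentiable.exists_factorization {f : ℂ → ℂ} (hf : Differentiable ℂ f) {c : ℂ} {r : ℝ}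
    (hr : 0 ≤ r) (h : ∀ z ∈ Metric.sphere c r, f z ≠ 0) :
    ∃ (s : Multiset ℂ) (g : ℂ → ℂ), (∀ a ∈ s, a ∈ Metric.ball c r) ∧ Differentiable ℂ g ∧
      (∀ z ∈ Metric.closedBall c r, g z ≠ 0) ∧ ∀ z, f z = (s.map fun a => z - a).prod * g z := by
  have hne : ∃ z, f z ≠ 0 := by
    obtain ⟨z, hz⟩ := (NormedSpace.sphere_nonempty (x := c)).2 hr
    exact ⟨z, h z hz⟩
  have hfin := hf.finite_zeros_inter_isCompact hne (isCompact_closedBall c r)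
  obtain ⟨s, g, hs, hg, hgZ, hfg⟩ := hf.exists_eq_multiset_prod_mul hfin.toFinset hne
  refine ⟨s, g, fun a ha => ?_, hg, fun z hz h0 => ?_, hfg⟩
  · obtain ⟨h1, h2⟩ := hfin.mem_toFinset.1 (hs a ha)
    rcases (Metric.mem_closedBall.1 h1).lt_or_eq with h3 | h3
    · exact h3
    · exact absurd h2 (h a h3)
  · exact hgZ z (hfin.mem_toFinset.2 ⟨hz, by rw [mem_ofPred_eq, hfg, h0, mul_zero]⟩) h0

theorem differentiable_multiset_prod_sub (s : Multiset ℂ) :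
    Differentiable ℂ fun z => (s.map fun a => z - a).prod := by
  induction s using Multiset.induction_on with
  | empty => simp
  | cons a s ih =>
    simp only [Multiset.map_cons, Multiset.prod_cons]
    exact (differentiable_id.sub_const a).mul ih

/-- The bridge between the two ways of counting: Rouché compares cardinalities of multisets, the
final statement speaks of orders of vanishing. -/
theorem analyticOrderAt_multiset_prod_mul (s : Multiset ℂ) {g : ℂ → ℂ} (hg : Differentiable ℂ g)
    {z : ℂ} (hz : g z ≠ 0) :
    analyticOrderAt (fun w => (s.map fun a => w - a).prod * g w) z = (s.count z : ℕ∞) := by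
  induction s using Multiset.induction_on with
  | empty => simpa using (hg.analyticAt z).analyticOrderAt_eq_zero.2 hz
  | cons a s ih =>
    have h1 : (fun w => ((a ::ₘ s).map fun a => w - a).prod * g w)
        = (fun w => w - a) * fun w => (s.map fun a => w - a).prod * g w := by
      ext w
      simp [mul_assoc]
    have h2 : AnalyticAt ℂ (fun w => (s.map fun a => w - a).prod * g w) z :=
      ((differentiable_multiset_prod_sub s).mul hg).analyticAt z
    rw [h1, analyticOrderAt_mul (by fun_prop) h2, ih]
    rcases eq_or_ne z a with rfl | hza
    · simp [add_comm]
    · rw [analyticOrderAt_id_sub_const_of_ne hza, Multiset.count_cons_of_ne hza, zero_add]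

theorem circleIntegrable_logDeriv {f : ℂ → ℂ} (hf : Differentiable ℂ f) {c : ℂ} {r : ℝ}
    (hr : 0 ≤ r) (h : ∀ z ∈ Metric.sphere c r, f z ≠ 0) : CircleIntegrable (logDeriv f) c r := by
  apply ContinuousOn.circleIntegrable hr
  have : Continuous (deriv f) := (hf.contDiff (n := 1)).continuous_deriv le_rfl
  exact this.continuousOn.div hf.continuous.continuousOn h

/-- The argument principle for an entire function in factorized form. -/
theorem circleIntegral_logDeriv_eq_card {g : ℂ → ℂ} (hg : Differentiable ℂ g) {c : ℂ}
    {r : ℝ} (hr : 0 ≤ r) (hgz : ∀ z ∈ Metric.closedBall c r, g z ≠ 0) (s : Multiset ℂ)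
    (hs : ∀ a ∈ s, a ∈ Metric.ball c r) :
    (∮ z in C(c, r), logDeriv (fun w => (s.map fun a => w - a).prod * g w) z)
      = s.card * (2 * π * Complex.I) := by
  induction s using Multiset.induction_on with
  | empty =>
    simp only [Multiset.map_zero, Multiset.prod_zero, one_mul, Multiset.card_zero, Nat.cast_zero,
      zero_mul]
    have hd : DifferentiableOn ℂ (logDeriv g) (Metric.closedBall c r) := by
      intro z hz
      exact (hg.analyticAt z).deriv.differentiableAt.differentiableWithinAt.div
        (hg z).differentiableWithinAt (hgz z hz)
    refine Complex.circleIntegral_eq_zero_of_differentiable_on_off_countable hr countable_empty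
      hd.continuousOn fun z hz => ?_
    exact (hd z (Metric.ball_subset_closedBall hz.1)).differentiableAt
      (Metric.closedBall_mem_nhds_of_mem hz.1)
  | cons a s ih =>
    have ha : a ∈ Metric.ball c r := hs a (Multiset.mem_cons_self a s)
    have hs' : ∀ b ∈ s, b ∈ Metric.ball c r := fun b hb => hs b (Multiset.mem_cons_of_mem hb)
    set F : ℂ → ℂ := fun w => (s.map fun a => w - a).prod * g w with hF
    have hFd : Differentiable ℂ F := (differentiable_multiset_prod_sub s).mul hg
    have hne : ∀ b ∈ Metric.ball c r, ∀ z ∈ Metric.sphere c r, z - b ≠ 0 := by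
      intro b hb z hz h0
      rw [sub_eq_zero.1 h0] at hz
      exact (Metric.mem_ball.1 hb).ne hz
    have hF0 : ∀ z ∈ Metric.sphere c r, F z ≠ 0 := by
      intro z hz
      refine mul_ne_zero (Multiset.prod_ne_zero fun h0 => ?_)
        (hgz z (Metric.sphere_subset_closedBall hz))
      obtain ⟨b, hb, hb0⟩ := Multiset.mem_map.1 h0
      exact hne b (hs' b hb) z hz hb0
    have h1 : (fun w => ((a ::ₘ s).map fun a => w - a).prod * g w) = fun w => (w - a) * F w := by
      ext w
      simp [hF, mul_assoc]
    have h2 : EqOn (logDeriv fun w => (w - a) * F w) (fun z => (z - a)⁻¹ + logDeriv F z)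
        (Metric.sphere c r) := by
      intro z hz
      have h3 : logDeriv (fun w => w - a) z = (z - a)⁻¹ := by
        simp [logDeriv_apply]
      rw [logDeriv_mul z (hne a ha z hz) (hF0 z hz) (by fun_prop) (hFd z), h3]
    rw [h1, circleIntegral.integral_congr hr h2, circleIntegral.integral_add, ih hs',
      circleIntegral.integral_sub_inv_of_mem_ball ha, Multiset.card_cons]
    · push_cast
      ring
    · exact ContinuousOn.circleIntegrable hr ((by fun_prop : ContinuousOn (fun z => z - a) _).inv₀
        (hne a ha))
    · exact circleIntegrable_logDeriv hFd hr hF0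

/-- **Rouché's theorem**, for entire functions on a disc. -/
theorem card_eq_card_of_norm_sub_lt {f f₀ : ℂ → ℂ} {c : ℂ} {r : ℝ} (hr : 0 ≤ r)
    (h : ∀ z ∈ Metric.sphere c r, ‖f z - f₀ z‖ < ‖f₀ z‖) {s s₀ : Multiset ℂ} {g g₀ : ℂ → ℂ}
    (hs : ∀ a ∈ s, a ∈ Metric.ball c r) (hg : Differentiable ℂ g)
    (hgz : ∀ z ∈ Metric.closedBall c r, g z ≠ 0)
    (hfg : ∀ z, f z = (s.map fun a => z - a).prod * g z)
    (hs₀ : ∀ a ∈ s₀, a ∈ Metric.ball c r) (hg₀ : Differentiable ℂ g₀)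
    (hgz₀ : ∀ z ∈ Metric.closedBall c r, g₀ z ≠ 0)
    (hfg₀ : ∀ z, f₀ z = (s₀.map fun a => z - a).prod * g₀ z) :
    s.card = s₀.card := by
  have hf : Differentiable ℂ f := by
    rw [funext hfg]
    exact (differentiable_multiset_prod_sub s).mul hg
  have hf₀ : Differentiable ℂ f₀ := by
    rw [funext hfg₀]
    exact (differentiable_multiset_prod_sub s₀).mul hg₀
  have h0 : ∀ z ∈ Metric.sphere c r, f₀ z ≠ 0 := by
    intro z hz h1
    have := h z hz
    rw [h1, norm_zero] at this
    exact absurd this (norm_nonneg _).not_gt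
  have h1 : ∀ z ∈ Metric.sphere c r, f z ≠ 0 := by
    intro z hz h1
    have := h z hz
    rw [h1, zero_sub, norm_neg] at this
    exact lt_irrefl _ this
  -- On the circle `f / f₀` lies in the disc of radius 1 about 1, hence in the slit plane, so its
  -- principal logarithm is a primitive of the difference of the logarithmic derivatives.
  have key : (∮ z in C(c, r), (logDeriv f z - logDeriv f₀ z)) = 0 := by
    refine circleIntegral.integral_eq_zero_of_hasDerivWithinAt hr
      (f := fun z => Complex.log (f z / f₀ z)) fun z hz => ?_
    have hsl : f z / f₀ z ∈ Complex.slitPlane := by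
      apply Complex.mem_slitPlane_of_norm_lt_one (z := f z / f₀ z - 1) _ |>
        fun h => by simpa using h
      rw [div_sub_one (h0 z hz), norm_div, div_lt_one (norm_pos_iff.2 (h0 z hz))]
      exact h z hz
    have hd := ((hf z).hasDerivAt.div (hf₀ z).hasDerivAt (h0 z hz)).clog hsl
    refine (hd.congr_deriv ?_).hasDerivWithinAt
    have := h0 z hz
    have := h1 z hz
    simp only [logDeriv_apply, Pi.div_apply]
    field_simp
  rw [circleIntegral.integral_sub (circleIntegrable_logDeriv hf hr h1)
    (circleIntegrable_logDeriv hf₀ hr h0), funext hfg, funext hfg₀,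
    circleIntegral_logDeriv_eq_card hg hr hgz s hs,
    circleIntegral_logDeriv_eq_card hg₀ hr hgz₀ s₀ hs₀, sub_eq_zero] at key
  have h2 : (2 * π * Complex.I : ℂ) ≠ 0 := by simp [Real.pi_ne_zero]
  exact_mod_cast mul_right_cancel₀ h2 key

/-- **Rouché's theorem**: if `f` is close to `f₀` on a circle, then the zeros of `f` inside form a
multiset of the same cardinality as those of `f₀`. -/
theorem exists_zeros_multiset_card_eq {f f₀ : ℂ → ℂ} (hf : Differentiable ℂ f)
    (hf₀ : Differentiable ℂ f₀) {c : ℂ} {r : ℝ} (hr : 0 ≤ r)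
    (h : ∀ z ∈ Metric.sphere c r, ‖f z - f₀ z‖ < ‖f₀ z‖) {s₀ : Multiset ℂ}
    (hs₀ : ∀ a ∈ s₀, a ∈ Metric.ball c r)
    (hc₀ : ∀ z ∈ Metric.ball c r, analyticOrderAt f₀ z = (s₀.count z : ℕ∞)) :
    ∃ s : Multiset ℂ, (∀ a ∈ s, a ∈ Metric.ball c r) ∧
      (∀ z ∈ Metric.ball c r, analyticOrderAt f z = (s.count z : ℕ∞)) ∧ s.card = s₀.card := by
  have h0 : ∀ z ∈ Metric.sphere c r, f₀ z ≠ 0 := by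
    intro z hz h1
    have := h z hz
    rw [h1, norm_zero] at this
    exact absurd this (norm_nonneg _).not_gt
  have h1 : ∀ z ∈ Metric.sphere c r, f z ≠ 0 := by
    intro z hz h1
    have := h z hz
    rw [h1, zero_sub, norm_neg] at this
    exact lt_irrefl _ this
  obtain ⟨s, g, hs, hg, hgz, hfg⟩ := hf.exists_factorization hr h1
  obtain ⟨s₁, g₁, hs₁, hg₁, hgz₁, hfg₁⟩ := hf₀.exists_factorization hr h0
  have hc : ∀ z ∈ Metric.ball c r, analyticOrderAt f z = (s.count z : ℕ∞) := by
    intro z hz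
    rw [funext hfg]
    exact analyticOrderAt_multiset_prod_mul s hg (hgz z (Metric.ball_subset_closedBall hz))
  -- The orders of `f₀` inside the disc determine its multiset of zeros, so the one from the
  -- factorization is the prescribed one.
  have he : s₁ = s₀ := by
    ext z
    by_cases hz : z ∈ Metric.ball c r
    · have h2 := hc₀ z hz
      rw [funext hfg₁, analyticOrderAt_multiset_prod_mul s₁ hg₁
        (hgz₁ z (Metric.ball_subset_closedBall hz))] at h2
      exact_mod_cast h2
    · rw [Multiset.count_eq_zero_of_notMem fun h => hz (hs₁ z h),
        Multiset.count_eq_zero_of_notMem fun h => hz (hs₀ z h)]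
  refine ⟨s, hs, hc, ?_⟩
  rw [card_eq_card_of_norm_sub_lt hr h hs hg hgz hfg hs₁ hg₁ hgz₁ hfg₁, he]

/-! ### Bounds for the complex sine and cosine -/

theorem norm_csin_le_exp_abs_im (z : ℂ) : ‖Complex.sin z‖ ≤ exp |z.im| := by
  have h1 : ‖Complex.exp (-z * Complex.I)‖ ≤ exp |z.im| := by
    rw [Complex.norm_exp]
    simpa using le_abs_self z.im
  have h2 : ‖Complex.exp (z * Complex.I)‖ ≤ exp |z.im| := by
    rw [Complex.norm_exp]
    simpa using neg_le_abs z.im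
  rw [Complex.sin, norm_div, norm_mul, Complex.norm_I, mul_one]
  have := norm_sub_le (Complex.exp (-z * Complex.I)) (Complex.exp (z * Complex.I))
  simp only [RCLike.norm_ofNat]
  linarith

theorem norm_ccos_le_exp_abs_im (z : ℂ) : ‖Complex.cos z‖ ≤ exp |z.im| := by
  have h1 : ‖Complex.exp (-z * Complex.I)‖ ≤ exp |z.im| := by
    rw [Complex.norm_exp]
    simpa using le_abs_self z.im
  have h2 : ‖Complex.exp (z * Complex.I)‖ ≤ exp |z.im| := by
    rw [Complex.norm_exp]
    simpa using neg_le_abs z.im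
  rw [Complex.cos, norm_div]
  have := norm_add_le (Complex.exp (z * Complex.I)) (Complex.exp (-z * Complex.I))
  simp only [RCLike.norm_ofNat]
  linarith

theorem exp_sub_exp_le_norm_csin (z : ℂ) :
    (exp |z.im| - exp (-|z.im|)) / 2 ≤ ‖Complex.sin z‖ := by
  have h1 : ‖Complex.exp (-z * Complex.I)‖ = exp z.im := by
    rw [Complex.norm_exp]
    simp
  have h2 : ‖Complex.exp (z * Complex.I)‖ = exp (-z.im) := by
    rw [Complex.norm_exp]
    simp
  rw [Complex.sin, norm_div, norm_mul, Complex.norm_I, mul_one]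
  have h3 := abs_norm_sub_norm_le (Complex.exp (-z * Complex.I)) (Complex.exp (z * Complex.I))
  rw [h1, h2, abs_le] at h3
  simp only [RCLike.norm_ofNat]
  rcases abs_cases z.im with ⟨h, -⟩ | ⟨h, -⟩ <;> rw [h]
  · linarith
  · rw [neg_neg]
    linarith

theorem abs_sin_re_le_norm_csin (z : ℂ) : |Real.sin z.re| ≤ ‖Complex.sin z‖ := by
  refine le_trans ?_ (Complex.abs_re_le_norm _)
  have h : (Complex.sin z).re = Real.sin z.re * Real.cosh z.im := by
    rw [Complex.sin_eq]
    simp [← Complex.ofReal_sin, ← Complex.ofReal_cos, ← Complex.ofReal_cosh,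
      ← Complex.ofReal_sinh]
  rw [h, abs_mul]
  exact le_mul_of_one_le_right (abs_nonneg _) ((Real.one_le_cosh _).trans (le_abs_self _))

/-- A quadratic error is enough: it is applied at points of size `O(1 / n)`, where an error `O(1 / n
^ 2)` is allowed. -/
theorem norm_csin_sub_self_le {z : ℂ} (hz : ‖z‖ ≤ 1) : ‖Complex.sin z - z‖ ≤ ‖z‖ ^ 2 := by
  have h1 : ∀ w : ℂ, ‖w‖ ≤ 1 → ‖Complex.exp w - 1 - w‖ ≤ ‖w‖ ^ 2 :=
    fun w hw => Complex.norm_exp_sub_one_sub_id_le hw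
  have h2 := h1 (-z * Complex.I) (by simpa using hz)
  have h3 := h1 (z * Complex.I) (by simpa using hz)
  have h4 : Complex.sin z - z = ((Complex.exp (-z * Complex.I) - 1 - -z * Complex.I) -
      (Complex.exp (z * Complex.I) - 1 - z * Complex.I)) * Complex.I / 2 := by
    rw [Complex.sin]
    linear_combination -z * Complex.I_mul_I
  rw [h4, norm_div, norm_mul, Complex.norm_I, mul_one]
  have := norm_sub_le (Complex.exp (-z * Complex.I) - 1 - -z * Complex.I)
    (Complex.exp (z * Complex.I) - 1 - z * Complex.I)
  simp only [norm_mul, norm_neg, Complex.norm_I, mul_one] at h2 h3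
  simp only [RCLike.norm_ofNat]
  linarith

theorem csin_mul_pi_eq (z : ℂ) (n : ℤ) :
    Complex.sin (z * π) = (-1) ^ n * Complex.sin ((z - n) * π) := by
  have h := Complex.sin_antiperiodic.add_int_mul_eq (x := (z - n) * π) n
  rw [Int.cast_negOnePow] at h
  rw [← h]
  congr 1
  ring

theorem two_mul_abs_le_abs_sin {x : ℝ} (hx : |x| ≤ 1 / 2) : 2 * |x| ≤ |Real.sin (x * π)| := by
  have key : ∀ y : ℝ, 0 ≤ y → y ≤ 1 / 2 → 2 * y ≤ Real.sin (y * π) := by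
    intro y h0 h1
    have := Real.mul_le_sin (x := y * π) (by positivity) (by nlinarith [pi_pos])
    have h2 : 2 / π * (y * π) = 2 * y := by field_simp
    linarith
  rcases abs_cases x with ⟨h, h0⟩ | ⟨h, h0⟩ <;> rw [h] at hx ⊢
  · exact (key x h0 hx).trans (le_abs_self _)
  · have := key (-x) (by linarith) hx
    rw [neg_mul, Real.sin_neg] at this
    exact this.trans (neg_le_abs _)

/-- Away from the integers `sin (π z)` is as large as its growth allows. -/
theorem exp_div_le_norm_csin {z : ℂ} (hz : ∀ n : ℤ, 1 / 4 ≤ ‖z - n‖) :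
    Real.exp (π * |z.im|) / 8 ≤ ‖Complex.sin (z * π)‖ := by
  have hpi := Real.pi_gt_three
  have hpi4 := Real.pi_le_four
  -- If `|Im z| ≥ 1/8`, then `E = exp (π |Im z|) ≥ 5/4`, so `1 / E ≤ 3 E / 4` and the exponential
  -- bound suffices. Otherwise `Re z` is at least `1/8` from the nearest integer, which gives `|sin|
  -- ≥ 1/4`, while `E ≤ 2`.
  rcases le_or_gt (1 / 8) |z.im| with h | h
  · have h1 := exp_sub_exp_le_norm_csin (z * π)
    have h2 : |(z * π).im| = π * |z.im| := by
      simp [abs_mul, abs_of_pos pi_pos, mul_comm]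
    rw [h2, Real.exp_neg] at h1
    set E := Real.exp (π * |z.im|) with hE
    have hE1 : 1 + π * |z.im| ≤ E := by
      rw [add_comm]
      exact Real.add_one_le_exp _
    have hE2 : 5 / 4 ≤ E := by nlinarith
    have hE3 : E⁻¹ ≤ 3 / 4 * E := by
      rw [inv_le_iff_one_le_mul₀ (by linarith)]
      nlinarith
    linarith
  · set n := round z.re
    have h1 : |z.re - n| ≤ 1 / 2 := abs_sub_round z.re
    have h2 : 1 / 8 ≤ |z.re - n| := by
      have h3 := (hz n).trans (Complex.norm_le_abs_re_add_abs_im (z - n))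
      simp only [Complex.sub_re, Complex.intCast_re, Complex.sub_im, Complex.intCast_im,
        sub_zero] at h3
      linarith
    have h3 := abs_sin_re_le_norm_csin ((z - n) * π)
    have h4 : ((z - n) * π : ℂ).re = (z.re - n) * π := by simp
    rw [h4] at h3
    have h5 := two_mul_abs_le_abs_sin h1
    have h6 : ‖Complex.sin (z * π)‖ = ‖Complex.sin ((z - n) * π)‖ := by
      rw [csin_mul_pi_eq z n]
      simp
    have h7 : Real.exp (π * |z.im|) ≤ 2 := by
      rw [← Real.exp_log two_pos]
      apply Real.exp_le_exp.2
      have := Real.log_two_gt_d9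
      have h8 := Real.pi_lt_d2
      nlinarith [abs_nonneg z.im]
    rw [h6]
    linarith

/-! ### The zeros of the model function `z ^ 3 sin (π z)` -/

/-- The integer `muZero k`. -/
def muZeroInt (k : ℤˣ × ℕ) : ℤ := (k.1 : ℤ) * ((k.2 - 1 : ℕ) : ℤ)

theorem muZero_eq_intCast (k : ℤˣ × ℕ) : muZero k = (muZeroInt k : ℝ) := by
  simp [muZero, muZeroInt]

theorem muZero_eq_intCast' (k : ℤˣ × ℕ) : (muZero k : ℂ) = (muZeroInt k : ℂ) := by
  rw [muZero_eq_intCast]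
  simp

theorem abs_muZeroInt (k : ℤˣ × ℕ) : |muZeroInt k| = ((k.2 - 1 : ℕ) : ℤ) := by
  rcases Int.units_eq_one_or k.1 with h | h <;> simp [muZeroInt, h]

/-- The index `k` with `muZero k = n`, for `n ≠ 0`. -/
def muZeroIndex (n : ℤ) : ℤˣ × ℕ := (if 0 < n then 1 else -1, n.natAbs + 1)

theorem muZeroInt_eq_iff {n : ℤ} (hn : n ≠ 0) (k : ℤˣ × ℕ) :
    muZeroInt k = n ↔ k = muZeroIndex n := by
  obtain ⟨u, j⟩ := k
  rcases Int.units_eq_one_or u with rfl | rfl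
  · simp only [muZeroInt, muZeroIndex, Units.val_one, one_mul, Prod.mk.injEq]
    split_ifs with h
    · simp only [true_and]
      omega
    · simp only [show (1 : ℤˣ) ≠ -1 by decide, false_and, iff_false]
      omega
  · simp only [muZeroInt, muZeroIndex, Units.val_neg, Units.val_one, Prod.mk.injEq]
    split_ifs with h
    · simp only [show (-1 : ℤˣ) ≠ 1 by decide, false_and, iff_false]
      omega
    · simp only [true_and]
      omega

theorem setOf_muZero_eq {n : ℤ} (hn : n ≠ 0) :
    {k | (muZero k : ℂ) = (n : ℂ)} = {muZeroIndex n} := by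
  ext k
  rw [mem_ofPred_eq, muZero_eq_intCast', Int.cast_inj, muZeroInt_eq_iff hn, mem_singleton_iff]

/-- The four indices are both signs at levels 0 and 1, merged by truncated subtraction. They account
for the triple zero of `z ^ 3` and the simple zero of the sine. -/
theorem encard_setOf_muZero_eq_zero : {k | (muZero k : ℂ) = 0}.encard = 4 := by
  have h : {k | (muZero k : ℂ) = 0}
      = ((Finset.univ ×ˢ Finset.range 2 : Finset (ℤˣ × ℕ)) : Set (ℤˣ × ℕ)) := by
    ext ⟨u, j⟩
    simp only [mem_ofPred_eq, muZero_eq_intCast', Int.cast_eq_zero, Finset.coe_product,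
      Finset.coe_univ, mem_prod, mem_univ, true_and, Finset.coe_range, mem_Iio]
    rw [← abs_eq_zero, abs_muZeroInt]
    simp only
    omega
  rw [h, Set.encard_coe_eq_coe_finsetCard, Finset.card_product]
  simp

theorem analyticOrderAt_csin_mul_pi (n : ℤ) :
    analyticOrderAt (fun z : ℂ => Complex.sin (z * π)) n = 1 := by
  have hd : ∀ z : ℂ, HasDerivAt (fun z : ℂ => Complex.sin (z * π)) (Complex.cos (z * π) * π) z := by
    intro z
    simpa using ((hasDerivAt_id z).mul_const (π : ℂ)).csin
  refine AnalyticAt.analyticOrderAt_eq_one_of_zero_deriv_ne_zero (by fun_prop)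
    (Complex.sin_int_mul_pi n) ?_
  rw [(hd _).deriv]
  refine mul_ne_zero (fun h => ?_) (by simp [Real.pi_ne_zero])
  have := Complex.sin_sq_add_cos_sq (n * π)
  simp [h, Complex.sin_int_mul_pi] at this

theorem analyticOrderAt_cube_mul_csin {a : ℂ} (ha : a ≠ 0) (z : ℂ) :
    analyticOrderAt (fun w => w ^ 3 * a * Complex.sin (w * π)) z
      = {k | (muZero k : ℂ) = z}.encard := by
  have h1 : (fun w => w ^ 3 * a * Complex.sin (w * π))
      = (fun w : ℂ => w ^ 3 * a) * fun w => Complex.sin (w * π) := rfl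
  by_cases hz : ∃ n : ℤ, z = n
  · obtain ⟨n, rfl⟩ := hz
    rw [h1, analyticOrderAt_mul (by fun_prop) (by fun_prop), analyticOrderAt_csin_mul_pi]
    rcases eq_or_ne n 0 with rfl | hn
    · have h2 : (fun w : ℂ => w ^ 3 * a) = (fun w => w - 0) ^ 3 * fun _ => a := by
        ext w
        simp
      have h3 : analyticOrderAt (fun _ : ℂ => a) 0 = 0 :=
        (analyticAt_const).analyticOrderAt_eq_zero.2 ha
      rw [Int.cast_zero, encard_setOf_muZero_eq_zero, h2,
        analyticOrderAt_mul (by fun_prop) (by fun_prop), h3]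
      have := analyticOrderAt_centeredMonomial (𝕜 := ℂ) (z₀ := 0) (n := 3)
      rw [this]
      rfl
    · rw [setOf_muZero_eq hn, encard_singleton,
        AnalyticAt.analyticOrderAt_eq_zero (by fun_prop) |>.2, zero_add]
      simp [ha, hn]
  · have h2 : {k | (muZero k : ℂ) = z} = ∅ := by
      ext k
      simp only [mem_ofPred_eq, mem_empty_iff_false, iff_false, muZero_eq_intCast']
      exact fun h => hz ⟨_, h.symm⟩
    rw [h2, encard_empty]
    refine (AnalyticAt.analyticOrderAt_eq_zero (by fun_prop)).2 ?_
    have hz0 : z ≠ 0 := fun h => hz ⟨0, by simpa using h⟩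
    refine mul_ne_zero (mul_ne_zero (pow_ne_zero 3 hz0) ha) fun h => ?_
    obtain ⟨n, hn⟩ := Complex.sin_eq_zero_iff.1 h
    exact hz ⟨n, mul_right_cancel₀ (by simp [Real.pi_ne_zero]) hn⟩

/-! ### Enumeration and asymptotics of zeros -/

/-- Serves to label the zeros in the large disc by the indices in `T`, in any order: only finitely
many are concerned, so the asymptotics do not see the choice. -/
theorem Finset.exists_val_map_eq {ι α : Type*} [DecidableEq ι] [Nonempty α] (T : Finset ι)
    (s : Multiset α) (h : s.card = T.card) : ∃ e : ι → α, T.val.map e = s := by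
  induction T using Finset.induction_on generalizing s with
  | empty =>
    rw [Finset.card_empty, Multiset.card_eq_zero] at h
    exact ⟨fun _ => Classical.arbitrary α, by simp [h]⟩
  | insert a T ha ih =>
    rw [Finset.card_insert_of_notMem ha] at h
    obtain ⟨b, hb⟩ := Multiset.card_pos_iff_exists_mem.1 (by omega : 0 < s.card)
    obtain ⟨t, rfl⟩ := Multiset.exists_cons_of_mem hb
    obtain ⟨e, he⟩ := ih t (by simpa using h)
    refine ⟨Function.update e a b, ?_⟩
    rw [Finset.insert_val_of_notMem ha, Multiset.map_cons, Function.update_self, ← he]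
    congr 1
    refine Multiset.map_congr rfl fun x hx => Function.update_of_ne ?_ _ _
    rintro rfl
    exact ha hx

theorem count_val_map_eq_encard {ι α : Type*} [DecidableEq α] (T : Finset ι) (e : ι → α) (z : α) :
    ((T.val.map e).count z : ℕ∞) = {k | k ∈ T ∧ e k = z}.encard := by
  have h : {k | k ∈ T ∧ e k = z} = ((T.filter fun k => z = e k) : Set ι) := by
    ext k
    simp [eq_comm]
  rw [h, Set.encard_coe_eq_coe_finsetCard, Multiset.count_map]
  rfl

theorem norm_muZero (k : ℤˣ × ℕ) : ‖(muZero k : ℂ)‖ = ((k.2 - 1 : ℕ) : ℝ) := by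
  rw [muZero_eq_intCast', Complex.norm_intCast, ← Int.cast_abs, abs_muZeroInt]
  simp

/-- If `f` is close to `f₀`, which has the same zeros as `z ^ 3 sin (π z)`, at all large `z` that
are not near an integer, then the zeros of `f` are close to those of `z ^ 3 sin (π z)`. -/
theorem exists_enumeration_of_zeros {f f₀ : ℂ → ℂ} (hf : Differentiable ℂ f)
    (hf₀ : Differentiable ℂ f₀)
    (ho : ∀ z, analyticOrderAt f₀ z = {k | (muZero k : ℂ) = z}.encard) {R : ℝ}
    (h : ∀ z : ℂ, R ≤ ‖z‖ → (∀ n : ℤ, 1 / 4 ≤ ‖z - n‖) → ‖f z - f₀ z‖ < ‖f₀ z‖) :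
    ∃ μ : ℤˣ × ℕ → ℂ, (∀ z, analyticOrderAt f z = {k | μ k = z}.encard) ∧
      ∀ᶠ k in cofinite, ‖μ k - muZero k‖ < 1 / 4 := by
  classical
  obtain ⟨N, hN⟩ := exists_nat_ge (R + 1)
  have hint : ∀ {m n : ℤ}, m ≠ n → (1 : ℝ) ≤ ‖(m : ℂ) - n‖ := by
    intro m n hmn
    rw [← Int.cast_sub, Complex.norm_intCast, ← Int.cast_abs]
    exact_mod_cast Int.one_le_abs (sub_ne_zero.2 hmn)
  have hnormint : ∀ n : ℤ, ‖(n : ℂ)‖ = ((|n| : ℤ) : ℝ) := by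
    intro n
    rw [Complex.norm_intCast, Int.cast_abs]
  -- the zeros in a large disc
  set T : Finset (ℤˣ × ℕ) := Finset.univ ×ˢ Finset.range (N + 2) with hT
  have hmemT : ∀ k : ℤˣ × ℕ, k ∈ T ↔ k.2 < N + 2 := by
    intro k
    rw [hT, Finset.mem_product, Finset.mem_range]
    exact and_iff_right (Finset.mem_univ _)
  have hmemT' : ∀ k : ℤˣ × ℕ, k ∈ T ↔ ‖(muZero k : ℂ)‖ < N + 1 / 2 := by
    intro k
    rw [hmemT, norm_muZero]
    constructor
    · intro hk
      have h1 : ((k.2 - 1 : ℕ) : ℝ) ≤ N := by exact_mod_cast (by omega : k.2 - 1 ≤ N)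
      linarith
    · intro hk
      have h1 : ((k.2 - 1 : ℕ) : ℝ) < N + 1 := by linarith
      have h2 : k.2 - 1 < N + 1 := by exact_mod_cast h1
      omega
  -- The circle `|z| = N + 1/2` keeps distance `1/2` from every integer. The set `T` has `2 (N + 2)
  -- = (2 N + 1) + 3` elements, the number of model zeros inside.
  have hbig : ∃ s : Multiset ℂ, (∀ a ∈ s, a ∈ Metric.ball (0 : ℂ) (N + 1 / 2)) ∧
      (∀ z ∈ Metric.ball (0 : ℂ) (N + 1 / 2), analyticOrderAt f z = (s.count z : ℕ∞)) ∧
      s.card = (T.val.map fun k => (muZero k : ℂ)).card := by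
    refine exists_zeros_multiset_card_eq hf hf₀ (by positivity) (fun z hz => ?_) ?_ ?_
    · rw [mem_sphere_zero_iff_norm] at hz
      refine h z (by linarith) fun n => ?_
      have h1 : (1 : ℝ) / 2 ≤ |‖z‖ - ‖(n : ℂ)‖| := by
        rw [hz, hnormint]
        rcases le_or_gt |n| (N : ℤ) with h2 | h2
        · have h3 : ((|n| : ℤ) : ℝ) ≤ N := by exact_mod_cast h2
          rw [abs_of_nonneg] <;> linarith
        · have h3 : (N : ℝ) + 1 ≤ ((|n| : ℤ) : ℝ) := by exact_mod_cast h2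
          rw [abs_of_nonpos] <;> linarith
      linarith [abs_norm_sub_norm_le z n]
    · intro a ha
      obtain ⟨k, hk, rfl⟩ := Multiset.mem_map.1 ha
      exact mem_ball_zero_iff.2 ((hmemT' k).1 hk)
    · intro z hz
      rw [ho, count_val_map_eq_encard]
      congr 1
      ext k
      simp only [mem_ofPred_eq]
      refine ⟨fun hk => ⟨(hmemT' k).2 ?_, hk⟩, fun hk => hk.2⟩
      rw [hk]
      exact mem_ball_zero_iff.1 hz
  obtain ⟨s, hs, hsc, hcard⟩ := hbig
  rw [Multiset.card_map] at hcard
  obtain ⟨e, he⟩ := T.exists_val_map_eq s hcard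
  -- the zeros near large integers
  have hsmall : ∀ n : ℤ, (N : ℤ) + 1 ≤ |n| → ∃ ζ ∈ Metric.ball (n : ℂ) (1 / 4),
      ∀ z ∈ Metric.ball (n : ℂ) (1 / 4),
        analyticOrderAt f z = {k | k = muZeroIndex n ∧ ζ = z}.encard := by
    intro n hn
    have hn0 : n ≠ 0 := by
      rintro rfl
      simp only [abs_zero] at hn
      omega
    have hnR : (N : ℝ) + 1 ≤ ‖(n : ℂ)‖ := by
      rw [hnormint]
      exact_mod_cast hn
    -- On this circle the distance to `n` is `1/4` and the distance to any other integer at least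
    -- `3/4`; inside, the model function has only the simple zero `n`.
    have hex : ∃ s : Multiset ℂ, (∀ a ∈ s, a ∈ Metric.ball (n : ℂ) (1 / 4)) ∧
        (∀ z ∈ Metric.ball (n : ℂ) (1 / 4), analyticOrderAt f z = (s.count z : ℕ∞)) ∧
        s.card = ({(n : ℂ)} : Multiset ℂ).card := by
      refine exists_zeros_multiset_card_eq hf hf₀ (by norm_num) (fun z hz => ?_) ?_ ?_
      · rw [mem_sphere_iff_norm] at hz
        refine h z ?_ fun m => ?_
        · have := norm_sub_norm_le (n : ℂ) z
          rw [norm_sub_rev] at this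
          linarith
        · rcases eq_or_ne m n with rfl | hmn
          · exact hz.ge
          · have h1 := hint hmn
            have h2 := norm_sub_le_norm_sub_add_norm_sub (m : ℂ) z n
            rw [norm_sub_rev (m : ℂ) z] at h2
            linarith
      · intro a ha
        rw [Multiset.mem_singleton.1 ha]
        exact Metric.mem_ball_self (by norm_num)
      · intro z hz
        rw [ho, Multiset.count_singleton]
        split_ifs with hzn
        · rw [hzn, setOf_muZero_eq hn0]
          simp
        · have h1 : {k | (muZero k : ℂ) = z} = ∅ := by
            ext k
            simp only [mem_ofPred_eq, mem_empty_iff_false, iff_false, muZero_eq_intCast']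
            rintro rfl
            have h2 : muZeroInt k ≠ n := fun h => hzn (by rw [h])
            have h3 := hint h2
            rw [mem_ball_iff_norm] at hz
            linarith
          rw [h1]
          simp
    obtain ⟨s', hs', hc', h1⟩ := hex
    obtain ⟨ζ, rfl⟩ := Multiset.card_eq_one.1 (by simpa using h1)
    refine ⟨ζ, hs' ζ (by simp), fun z hz => ?_⟩
    rw [hc' z hz, Multiset.count_singleton]
    split_ifs with hzζ
    · simp [hzζ]
    · have : ζ ≠ z := fun h => hzζ h.symm
      simp [this]
  choose! ζ hζ hζo using hsmall
  have hlarge : ∀ k : ℤˣ × ℕ, k ∉ T → (N : ℤ) + 1 ≤ |muZeroInt k| := by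
    intro k hk
    rw [hmemT] at hk
    rw [abs_muZeroInt]
    omega
  have hμball : ∀ k : ℤˣ × ℕ, k ∉ T → ‖ζ (muZeroInt k) - (muZeroInt k : ℂ)‖ < 1 / 4 :=
    fun k hk => mem_ball_iff_norm.1 (hζ _ (hlarge k hk))
  refine ⟨fun k => if k ∈ T then e k else ζ (muZeroInt k), fun z => ?_, ?_⟩
  · rcases lt_or_ge ‖z‖ (N + 1 / 2) with hz | hz
    · rw [hsc z (mem_ball_zero_iff.2 hz), ← he, count_val_map_eq_encard]
      congr 1
      ext k
      simp only [mem_ofPred_eq]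
      by_cases hk : k ∈ T
      · simp [hk]
      · simp only [hk, false_and, if_false, false_iff]
        rintro rfl
        have h1 := hμball k hk
        have h2 : (N : ℝ) + 1 ≤ ‖(muZeroInt k : ℂ)‖ := by
          rw [hnormint]
          exact_mod_cast hlarge k hk
        have h3 := norm_sub_norm_le (muZeroInt k : ℂ) (ζ (muZeroInt k))
        rw [norm_sub_rev] at h3
        linarith
    · have hTz : ∀ k ∈ T, e k ≠ z := by
        rintro k hk rfl
        have h1 : e k ∈ s := he ▸ Multiset.mem_map_of_mem e hk
        exact absurd (mem_ball_zero_iff.1 (hs _ h1)) hz.not_gt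
      have hset : {k | (if k ∈ T then e k else ζ (muZeroInt k)) = z}
          = {k | k ∉ T ∧ ζ (muZeroInt k) = z} := by
        ext k
        by_cases hk : k ∈ T
        · simp [hk, hTz k hk]
        · simp [hk]
      rw [hset]
      -- Outside the large disc, either `z` lies in one of the disjoint small discs, where a single
      -- index can produce it, or `z` is far from all integers and `f z ≠ 0`. Small discs about `n`
      -- with `|n| ≤ N` do not reach this region.
      by_cases hex : ∃ n : ℤ, (N : ℤ) + 1 ≤ |n| ∧ ‖z - n‖ < 1 / 4
      · obtain ⟨n, hn, hzn⟩ := hex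
        have hn0 : n ≠ 0 := by
          rintro rfl
          simp only [abs_zero] at hn
          omega
        rw [hζo n hn z (mem_ball_iff_norm.2 hzn)]
        congr 1
        ext k
        simp only [mem_ofPred_eq]
        constructor
        · rintro ⟨rfl, h1⟩
          have h2 : muZeroInt (muZeroIndex n) = n := (muZeroInt_eq_iff hn0 _).2 rfl
          refine ⟨fun hk => ?_, by rw [h2, h1]⟩
          rw [hmemT] at hk
          have h3 := abs_muZeroInt (muZeroIndex n)
          rw [h2] at h3
          omega
        · rintro ⟨hk, h1⟩
          have h2 : muZeroInt k = n := by
            by_contra hne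
            have h3 := hint hne
            have h4 := hμball k hk
            rw [h1, norm_sub_rev] at h4
            have := norm_sub_le_norm_sub_add_norm_sub (muZeroInt k : ℂ) z n
            linarith
          exact ⟨(muZeroInt_eq_iff hn0 k).1 h2, by rw [← h2, h1]⟩
      · push Not at hex
        have hfar : ∀ n : ℤ, 1 / 4 ≤ ‖z - n‖ := by
          intro n
          rcases le_or_gt ((N : ℤ) + 1) |n| with hn | hn
          · exact hex n hn
          · have h2 : ‖(n : ℂ)‖ ≤ N := by
              rw [hnormint]
              exact_mod_cast Int.lt_add_one_iff.1 hn
            have := norm_sub_norm_le z n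
            linarith
        have hlt := h z (by linarith) hfar
        have hfz : f z ≠ 0 := by
          intro h0
          rw [h0, zero_sub, norm_neg] at hlt
          exact lt_irrefl _ hlt
        rw [(hf.analyticAt z).analyticOrderAt_eq_zero.2 hfz, eq_comm, encard_eq_zero]
        ext k
        simp only [mem_ofPred_eq, mem_empty_iff_false, iff_false, not_and]
        rintro hk rfl
        exact absurd (hμball k hk) (hfar _).not_gt
  · have : ∀ᶠ k in cofinite, k ∉ T := T.eventually_cofinite_notMem
    filter_upwards [this] with k hk
    simp only [hk, if_false]
    rw [muZero_eq_intCast']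
    exact hμball k hk

theorem norm_le_two_mul_norm_csin {w : ℂ} (hw : ‖w‖ ≤ 1 / 4) :
    ‖w‖ ≤ 2 * ‖Complex.sin (w * π)‖ := by
  have h3 := Real.pi_gt_three
  have h4 := Real.pi_lt_d2
  have hn : ‖w * π‖ = ‖w‖ * π := by simp [abs_of_pos pi_pos]
  -- Here `63 / 80 = 3.15 / 4`. After the quadratic error at least `17 / 80` of `‖w * π‖ ≥ 3 ‖w‖` is
  -- left, which is more than `‖w‖ / 2`.
  have h1 : ‖w * π‖ ≤ 63 / 80 := by
    rw [hn]
    nlinarith [norm_nonneg w]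
  have h2 := norm_csin_sub_self_le (h1.trans (by norm_num))
  have h5 := norm_sub_norm_le (w * π) (Complex.sin (w * π))
  rw [norm_sub_rev] at h5
  have h6 : ‖w * π‖ ^ 2 ≤ 63 / 80 * ‖w * π‖ := by nlinarith [norm_nonneg (w * π)]
  have h7 : 3 * ‖w‖ ≤ ‖w * π‖ := by
    rw [hn]
    nlinarith [norm_nonneg w]
  linarith [norm_nonneg w]

/-- The position of a zero of `a z ^ 3 sin (π z) + z ^ 2 H z + E z` near a large integer `n`. -/
theorem exists_norm_sub_le_of_zero {a : ℂ} (ha : a ≠ 0) {H E : ℂ → ℂ} {R C L : ℝ}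
    (hC : 0 ≤ C) (hL : 0 ≤ L)
    (hH : ∀ z : ℂ, |z.im| ≤ 1 → ‖H z‖ ≤ C)
    (hE : ∀ z : ℂ, |z.im| ≤ 1 → R ≤ ‖z‖ → ‖E z‖ ≤ C * ‖z‖)
    (hHL : ∀ z : ℂ, ∀ n : ℤ, |z.im| ≤ 1 → ‖H z - H n‖ ≤ L * ‖z - n‖) :
    ∃ K, ∀ (n : ℤ) (z : ℂ), R + 1 ≤ |(n : ℝ)| → 1 ≤ |(n : ℝ)| → ‖z - n‖ < 1 / 4 →
      a * z ^ 3 * Complex.sin (z * π) + z ^ 2 * H z + E z = 0 →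
      ‖z - (n - 1 / (n * π) * ((-1) ^ n * H n / a))‖ ≤ K * (1 / (n : ℝ) ^ 2) := by
  have ha' : 0 < ‖a‖ := norm_pos_iff.2 ha
  -- `K₁ / N` is the crude bound for `‖z - n‖` obtained in the first pass (`hε`) and fed into the
  -- second.
  set K₁ : ℝ := 12 * C / ‖a‖ with hK₁
  have hK₁0 : 0 ≤ K₁ := by positivity
  refine ⟨16 * K₁ ^ 2 + (2 * L * K₁ + 6 * C) / ‖a‖, fun n z hnR hn1 hzn hz => ?_⟩
  set N : ℝ := |(n : ℝ)| with hN
  have hnN : ‖(n : ℂ)‖ = N := by rw [Complex.norm_intCast]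
  have hN0 : 0 < N := by linarith
  have hn0 : (n : ℂ) ≠ 0 := norm_pos_iff.1 (by rw [hnN]; exact hN0)
  have hzN : N - 1 / 4 ≤ ‖z‖ := by
    have := norm_sub_norm_le (n : ℂ) z
    rw [norm_sub_rev, hnN] at this
    linarith
  have hzN2 : N / 2 ≤ ‖z‖ := by linarith
  have hz0' : 0 < ‖z‖ := by linarith
  have hz0 : z ≠ 0 := norm_pos_iff.1 hz0'
  have hinv : ‖z‖⁻¹ ≤ 2 / N := by
    rw [← inv_div]
    exact inv_anti₀ (by positivity) hzN2
  have him : |z.im| ≤ 1 := by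
    have := (Complex.abs_im_le_norm (z - n)).trans hzn.le
    simp only [Complex.sub_im, Complex.intCast_im, sub_zero] at this
    linarith
  have himn : |((n : ℂ)).im| ≤ 1 := by simp
  set σ : ℂ := (-1) ^ n with hσ
  have hσn : ‖σ‖ = 1 := by simp [hσ]
  have hσσ : σ * σ = 1 := by
    rw [hσ, ← mul_zpow]
    simp
  set s := Complex.sin ((z - n) * π) with hs
  rw [csin_mul_pi_eq z n] at hz
  have hEz : ‖E z / z ^ 3‖ ≤ 4 * C / N ^ 2 := by
    rw [norm_div, norm_pow, div_le_iff₀ (by positivity)]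
    calc ‖E z‖ ≤ C * ‖z‖ := hE z him (by linarith)
      _ = C * ‖z‖ ^ 3 * (‖z‖⁻¹) ^ 2 := by field_simp
      _ ≤ C * ‖z‖ ^ 3 * (2 / N) ^ 2 := by gcongr
      _ = 4 * C / N ^ 2 * ‖z‖ ^ 3 := by ring
  have hEz' : ‖E z / z ^ 3‖ ≤ 4 * C / N := by
    refine hEz.trans ?_
    gcongr
    nlinarith
  have hHz : ‖H z / z‖ ≤ 2 * C / N := by
    rw [norm_div, div_eq_mul_inv]
    calc ‖H z‖ * ‖z‖⁻¹ ≤ C * (2 / N) := by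
          gcongr
          exact hH z him
      _ = 2 * C / N := by ring
  have hse : s = -(σ / a) * (H z / z + E z / z ^ 3) := by
    field_simp
    linear_combination σ * hz - a * z ^ 3 * s * hσσ
  have hsN : ‖s‖ ≤ 6 * C / ‖a‖ / N := by
    rw [hse, norm_mul, norm_neg, norm_div, hσn]
    calc 1 / ‖a‖ * ‖H z / z + E z / z ^ 3‖ ≤ 1 / ‖a‖ * (2 * C / N + 4 * C / N) := by
          gcongr
          exact (norm_add_le _ _).trans (add_le_add hHz hEz')
      _ = 6 * C / ‖a‖ / N := by
          field_simp
          ring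
  have hε : ‖z - n‖ ≤ K₁ / N := by
    refine (norm_le_two_mul_norm_csin hzn.le).trans ?_
    calc 2 * ‖s‖ ≤ 2 * (6 * C / ‖a‖ / N) := by gcongr
      _ = K₁ / N := by
        rw [hK₁]
        ring
  have hb1 : ‖(z - n) * π - s‖ ≤ 16 * K₁ ^ 2 / N ^ 2 := by
    have hp : ‖(z - n) * π‖ = ‖z - n‖ * π := by simp [abs_of_pos pi_pos]
    have h1 : ‖(z - n) * π‖ ≤ 1 := by
      rw [hp]
      nlinarith [Real.pi_le_four, norm_nonneg (z - n), pi_pos]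
    rw [norm_sub_rev]
    refine (norm_csin_sub_self_le h1).trans ?_
    rw [hp]
    calc (‖z - n‖ * π) ^ 2 ≤ (K₁ / N * 4) ^ 2 := by
          gcongr
          exact Real.pi_le_four
      _ = 16 * K₁ ^ 2 / N ^ 2 := by ring
  have hb2 : ‖(H n - H z) / z‖ ≤ 2 * L * K₁ / N ^ 2 := by
    rw [norm_div, div_eq_mul_inv, norm_sub_rev]
    calc ‖H z - H n‖ * ‖z‖⁻¹ ≤ (L * (K₁ / N)) * (2 / N) := by
          gcongr
          exact (hHL z n him).trans (by gcongr)
      _ = 2 * L * K₁ / N ^ 2 := by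
          field_simp
  have hb3 : ‖H n * (z - n) / (n * z)‖ ≤ 2 * C / N ^ 2 := by
    rw [norm_div, norm_mul, norm_mul, hnN, div_eq_mul_inv, mul_inv]
    calc ‖H n‖ * ‖z - n‖ * (N⁻¹ * ‖z‖⁻¹) ≤ C * 1 * (N⁻¹ * (2 / N)) := by
          gcongr
          · exact hH n himn
          · linarith
      _ = 2 * C / N ^ 2 := by
          field_simp
  have hpi : (π : ℂ) ≠ 0 := by simp [Real.pi_ne_zero]
  -- An exact identity. The four errors are the linearisation of the sine, the variation of `H`
  -- between `n` and `z`, the replacement of `1 / z` by `1 / n`, and `E`; each is `O(1 / N ^ 2)`.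
  have hmain : z - (n - 1 / (n * π) * (σ * H n / a)) =
      1 / π * (((z - n) * π - s) +
        σ / a * ((H n - H z) / z + H n * (z - n) / (n * z) - E z / z ^ 3)) := by
    rw [hse]
    field_simp
    ring
  rw [hmain, norm_mul]
  have h1pi : ‖(1 / π : ℂ)‖ ≤ 1 := by
    rw [norm_div, norm_one, Complex.norm_real, Real.norm_of_nonneg pi_pos.le]
    rw [div_le_one pi_pos]
    linarith [Real.pi_gt_three]
  have hfin : ‖((z - n) * π - s) +
        σ / a * ((H n - H z) / z + H n * (z - n) / (n * z) - E z / z ^ 3)‖ ≤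
      16 * K₁ ^ 2 / N ^ 2 +
        1 / ‖a‖ * (2 * L * K₁ / N ^ 2 + 2 * C / N ^ 2 + 4 * C / N ^ 2) := by
    refine (norm_add_le _ _).trans (add_le_add hb1 ?_)
    rw [norm_mul, norm_div, hσn]
    gcongr
    exact (norm_sub_le _ _).trans (add_le_add ((norm_add_le _ _).trans (add_le_add hb2 hb3)) hEz)
  calc _ ≤ 1 * _ := mul_le_mul h1pi hfin (norm_nonneg _) zero_le_one
    _ = (16 * K₁ ^ 2 + (2 * L * K₁ + 6 * C) / ‖a‖) * (1 / N ^ 2) := by ring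
    _ = _ := by rw [hN, sq_abs]

theorem tendsto_muZero_cofinite : Tendsto (fun k => |muZero k|) cofinite atTop := by
  rw [tendsto_atTop]
  intro b
  obtain ⟨N, hN⟩ := exists_nat_ge b
  have h := (Finset.univ ×ˢ Finset.range (N + 1) : Finset (ℤˣ × ℕ)).eventually_cofinite_notMem
  filter_upwards [h] with k hk
  have h1 : |muZero k| = ((k.2 - 1 : ℕ) : ℝ) := by
    rw [← norm_muZero, Complex.norm_real, Real.norm_eq_abs]
  rw [h1]
  have h2 : N + 1 ≤ k.2 := by
    by_contra h3
    exact hk (Finset.mem_product.2 ⟨Finset.mem_univ _, Finset.mem_range.2 (by omega)⟩)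
  have h3 : (N : ℝ) ≤ ((k.2 - 1 : ℕ) : ℝ) := by exact_mod_cast (by omega : N ≤ k.2 - 1)
  linarith

/-- Enumeration and asymptotics of the zeros of an entire function of the form
`a z ^ 3 sin (π z) + z ^ 2 H z + E z` with lower order terms `H` and `E`. -/
theorem exists_enumeration_and_asymptotics {f : ℂ → ℂ} (hf : Differentiable ℂ f) {a : ℂ}
    (ha : a ≠ 0) {H E : ℂ → ℂ} {R C L : ℝ} (hC : 0 ≤ C) (hL : 0 ≤ L)
    (hfe : ∀ z, f z = a * z ^ 3 * Complex.sin (z * π) + z ^ 2 * H z + E z)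
    (hH : ∀ z : ℂ, ‖H z‖ ≤ C * exp (π * |z.im|))
    (hE : ∀ z : ℂ, R ≤ ‖z‖ → ‖E z‖ ≤ C * ‖z‖ * exp (π * |z.im|))
    (hHL : ∀ z : ℂ, ∀ n : ℤ, |z.im| ≤ 1 → ‖H z - H n‖ ≤ L * ‖z - n‖)
    {G : ℝ → ℝ} (hG : ∀ n : ℤ, (-1) ^ n * H n / a = G n) :
    ∃ μ : ℤˣ × ℕ → ℂ, (∀ z, analyticOrderAt f z = {k | μ k = z}.encard) ∧
      (fun k => μ k - ((muZero k - 1 / (muZero k * π) * G (muZero k) : ℝ) : ℂ))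
        =O[cofinite] fun k => 1 / (muZero k) ^ 2 := by
  have ha' : 0 < ‖a‖ := norm_pos_iff.2 ha
  set f₀ : ℂ → ℂ := fun z => z ^ 3 * a * Complex.sin (z * π) with hf₀
  have hf₀d : Differentiable ℂ f₀ := by fun_prop
  -- Beyond `16 C / ‖a‖` the lower bound `‖z‖ ^ 3 ‖a‖ / 8` for the cubic term exceeds the bound `2 C
  -- ‖z‖ ^ 2` for the rest, up to the common exponential.
  set R' : ℝ := max (max R 1) (16 * C / ‖a‖ + 1) with hR'
  obtain ⟨μ, hμ, hμn⟩ := exists_enumeration_of_zeros hf hf₀d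
    (analyticOrderAt_cube_mul_csin ha) (R := R') (fun z hz hzn => by
      have hzR : R ≤ ‖z‖ := ((le_max_left _ _).trans (le_max_left _ _)).trans hz
      have hz1 : 1 ≤ ‖z‖ := ((le_max_right _ _).trans (le_max_left _ _)).trans hz
      have hzC : 16 * C / ‖a‖ < ‖z‖ := by
        have := (le_max_right (max R 1) _).trans hz
        linarith
      have hdiff : f z - f₀ z = z ^ 2 * H z + E z := by
        rw [hfe, hf₀]
        ring
      set e := exp (π * |z.im|) with he
      have he0 : 0 < e := exp_pos _
      have h1 : ‖f z - f₀ z‖ ≤ 2 * C * ‖z‖ ^ 2 * e := by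
        rw [hdiff]
        calc _ ≤ ‖z‖ ^ 2 * ‖H z‖ + ‖E z‖ := by
              rw [← norm_pow, ← norm_mul]
              exact norm_add_le _ _
          _ ≤ ‖z‖ ^ 2 * (C * e) + C * ‖z‖ ^ 2 * e := by
              gcongr
              · exact hH z
              · refine (hE z hzR).trans ?_
                gcongr
                nlinarith
          _ = _ := by ring
      have h2 : ‖z‖ ^ 3 * ‖a‖ * (e / 8) ≤ ‖f₀ z‖ := by
        rw [hf₀, norm_mul, norm_mul, norm_pow]
        gcongr
        exact exp_div_le_norm_csin hzn
      refine lt_of_le_of_lt h1 (lt_of_lt_of_le ?_ h2)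
      rw [div_lt_iff₀ ha'] at hzC
      have h3 : 0 < ‖z‖ ^ 2 * e := by positivity
      nlinarith)
  refine ⟨μ, hμ, ?_⟩
  -- In the strip `|Im z| ≤ 1` the exponential factor is at most `exp π` and is absorbed in the
  -- constant.
  obtain ⟨K, hK⟩ := exists_norm_sub_le_of_zero ha (H := H) (E := E) (R := R)
    (C := C * exp π) (L := L) (by positivity) hL
    (fun z hz => (hH z).trans (by
      gcongr
      nlinarith [pi_pos]))
    (fun z hz hzR => (hE z hzR).trans (by
      rw [mul_right_comm]
      gcongr
      nlinarith [pi_pos])) hHL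
  refine IsBigO.of_bound K ?_
  filter_upwards [hμn, tendsto_muZero_cofinite.eventually_ge_atTop (R + 1),
    tendsto_muZero_cofinite.eventually_ge_atTop 1] with k h1 h2 h3
  have h0 : f (μ k) = 0 := by
    refine ((hf.analyticAt (μ k)).analyticOrderAt_ne_zero).1 ?_
    rw [hμ, Ne, encard_eq_zero]
    exact Set.nonempty_iff_ne_empty.1 ⟨k, rfl⟩
  rw [hfe] at h0
  rw [muZero_eq_intCast'] at h1
  rw [muZero_eq_intCast] at h2 h3 ⊢
  have h4 := hK (muZeroInt k) (μ k) h2 h3 h1 h0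
  rw [hG] at h4
  rw [Real.norm_of_nonneg (by positivity : (0 : ℝ) ≤ 1 / (muZeroInt k : ℝ) ^ 2)]
  push_cast
  exact h4

/-! ### Retarded Volterra equations on `[0, π]` -/

theorem integrableOn_Icc_of_continuousOn_sdiff_finite {X : Type*} [NormedAddCommGroup X]
    {F : ℝ → X} {a b C : ℝ} {S : Set ℝ}
    (hS : S.Finite) (hF : ContinuousOn F (Icc a b \ S)) (hC : ∀ t ∈ Icc a b \ S, ‖F t‖ ≤ C) :
    MeasureTheory.IntegrableOn F (Icc a b) := by
  have hm : MeasurableSet (Icc a b \ S) := measurableSet_Icc.diff hS.measurableSet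
  have h1 : MeasureTheory.IntegrableOn F (Icc a b \ S) := by
    refine MeasureTheory.IntegrableOn.of_bound ?_ (hF.aestronglyMeasurable hm) C ?_
    · exact (MeasureTheory.measure_mono sdiff_subset).trans_lt measure_Icc_lt_top
    · exact (MeasureTheory.ae_restrict_iff' hm).2 (Eventually.of_forall hC)
  refine h1.congr_set_ae ?_
  have h2 := hS.countable.ae_notMem MeasureTheory.volume
  filter_upwards [h2] with t ht
  exact propext ⟨fun h => ⟨h, ht⟩, fun h => h.1⟩

theorem intervalIntegrable_of_continuousOn_sdiff_finite {X : Type*} [NormedAddCommGroup X]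
    {F : ℝ → X} {a b C : ℝ} {S : Set ℝ}
    (hS : S.Finite) (hF : ContinuousOn F (Icc a b \ S)) (hC : ∀ t ∈ Icc a b \ S, ‖F t‖ ≤ C)
    {c d : ℝ} (hc : c ∈ Icc a b) (hd : d ∈ Icc a b) :
    IntervalIntegrable F MeasureTheory.volume c d := by
  have h := integrableOn_Icc_of_continuousOn_sdiff_finite hS hF hC
  refine (h.mono_set ?_).intervalIntegrable
  exact OrdConnected.uIcc_subset ordConnected_Icc hc hd

theorem norm_integral_le_of_norm_le_off_finite {F : ℝ → ℂ} {g : ℝ → ℝ} {a b : ℝ} {S : Set ℝ}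
    (hS : S.Finite) (hab : a ≤ b) (h : ∀ t ∈ Icc a b \ S, ‖F t‖ ≤ g t)
    (hg : IntervalIntegrable g MeasureTheory.volume a b) :
    ‖∫ t in a..b, F t‖ ≤ ∫ t in a..b, g t := by
  refine intervalIntegral.norm_integral_le_of_norm_le hab ?_ hg
  filter_upwards [hS.countable.ae_notMem MeasureTheory.volume] with t ht ht'
  exact h t ⟨Ioc_subset_Icc_self ht', ht⟩

/-- `1 - (-x) ^ n` is a unit by the Neumann series and is the product of `1 + x` with a geometric
sum that commutes with it; a commuting factor of a unit is a unit. -/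
theorem isUnit_one_add_of_norm_pow_lt_one {R : Type*} [NormedRing R] [HasSummableGeomSeries R]
    {x : R} {n : ℕ} (hn : ‖x ^ n‖ < 1) : IsUnit (1 + x) := by
  have hn' : ‖(-x) ^ n‖ < 1 := by
    rcases Nat.even_or_odd n with h1 | h1
    · rwa [h1.neg_pow]
    · rwa [h1.neg_pow, norm_neg]
  have h1 := isUnit_one_sub_of_norm_lt_one hn'
  rw [← mul_neg_geom_sum] at h1
  have hcomm : Commute (1 - -x) (∑ i ∈ Finset.range n, (-x) ^ i) := by
    refine Commute.sum_right _ _ _ fun i _ => Commute.pow_right ?_ i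
    exact (Commute.one_left _).sub_left (Commute.refl _)
  have h2 := (hcomm.isUnit_mul_iff.1 h1).1
  rwa [sub_neg_eq_add] at h2

theorem differentiable_add_sq_smul {E : Type*} [NormedAddCommGroup E] [NormedSpace ℂ E]
    (a b : E) : Differentiable ℂ fun μ : ℂ => a + μ ^ 2 • b := by
  fun_prop

/-- A weight `w` and a retarded argument `σ` on `[0, π]`, continuous off the finite set `S`. -/
structure IsRetardedKernel (w : ℝ → ℂ) (σ : ℝ → ℝ) (S : Set ℝ) (W : ℝ) : Prop where
  finite : S.Finite
  continuousOn_weight : ContinuousOn w (Icc 0 π \ S)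
  continuousOn_arg : ContinuousOn σ (Icc 0 π \ S)
  bound_nonneg : 0 ≤ W
  norm_weight_le : ∀ t ∈ Icc 0 π \ S, ‖w t‖ ≤ W
  arg_nonneg : ∀ t ∈ Icc 0 π \ S, 0 ≤ σ t
  arg_le : ∀ t ∈ Icc 0 π \ S, σ t ≤ t

/-- Plain integration is the trivial kernel, so both integrations in the Volterra operator share the
same estimates. -/
theorem isRetardedKernel_one : IsRetardedKernel 1 id ∅ 1 where
  finite := finite_empty
  continuousOn_weight := continuousOn_const
  continuousOn_arg := continuousOn_id
  bound_nonneg := zero_le_one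
  norm_weight_le t _ := by simp
  arg_nonneg t ht := ht.1.1
  arg_le t _ := le_rfl

namespace IsRetardedKernel

variable {w : ℝ → ℂ} {σ : ℝ → ℝ} {S : Set ℝ} {W : ℝ}

theorem arg_mem (h : IsRetardedKernel w σ S W) {t : ℝ} (ht : t ∈ Icc 0 π \ S) :
    σ t ∈ Icc 0 π :=
  ⟨h.arg_nonneg t ht, (h.arg_le t ht).trans ht.1.2⟩

theorem continuousOn_mul_comp (h : IsRetardedKernel w σ S W) {f : ℝ → ℂ} (hf : Continuous f) :
    ContinuousOn (fun τ => w τ * f (σ τ)) (Icc 0 π \ S) :=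
  h.continuousOn_weight.mul (hf.comp_continuousOn h.continuousOn_arg)

/-- The point where retardation is used: a monotone bound at `σ t ≤ t` is also a bound at `t`. All
growth estimates below rest on this. -/
theorem norm_mul_comp_le (h : IsRetardedKernel w σ S W) {f : ℝ → ℂ} {F : ℝ → ℝ}
    (hF : MonotoneOn F (Icc 0 π)) (hf : ∀ t ∈ Icc 0 π, ‖f t‖ ≤ F t) {t : ℝ}
    (ht : t ∈ Icc 0 π \ S) : ‖w t * f (σ t)‖ ≤ W * F t := by
  rw [norm_mul]
  have h1 := h.arg_mem ht
  exact mul_le_mul (h.norm_weight_le t ht) ((hf _ h1).trans (hF h1 ht.1 (h.arg_le t ht)))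
    (norm_nonneg _) h.bound_nonneg

theorem intervalIntegrable_mul (h : IsRetardedKernel w σ S W) {f : ℝ → ℂ} (hf : Continuous f)
    {k : ℝ → ℂ} (hk : Continuous k) {c d : ℝ} (hc : c ∈ Icc 0 π) (hd : d ∈ Icc 0 π) :
    IntervalIntegrable (fun τ => w τ * f (σ τ) * k τ) MeasureTheory.volume c d := by
  obtain ⟨M, hM⟩ := isCompact_Icc.exists_bound_of_continuousOn (s := Icc 0 π) hf.continuousOn
  obtain ⟨M', hM'⟩ := isCompact_Icc.exists_bound_of_continuousOn (s := Icc 0 π) hk.continuousOn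
  refine intervalIntegrable_of_continuousOn_sdiff_finite (C := W * M * M') h.finite
    ((h.continuousOn_mul_comp hf).fun_mul hk.continuousOn) (fun t ht => ?_) hc hd
  have h1 := h.norm_mul_comp_le (F := fun _ => M) monotoneOn_const hM ht
  rw [norm_mul]
  exact mul_le_mul h1 (hM' t ht.1) (norm_nonneg _) ((norm_nonneg _).trans h1)

theorem intervalIntegrable (h : IsRetardedKernel w σ S W) {f : ℝ → ℂ} (hf : Continuous f)
    {c d : ℝ} (hc : c ∈ Icc 0 π) (hd : d ∈ Icc 0 π) :
    IntervalIntegrable (fun τ => w τ * f (σ τ)) MeasureTheory.volume c d := by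
  simpa using h.intervalIntegrable_mul hf (k := fun _ => 1) continuous_const hc hd

theorem norm_integral_le_pow (h : IsRetardedKernel w σ S W) {f : ℝ → ℂ}
    {c : ℝ} (hc : 0 ≤ c) {n : ℕ} (hfn : ∀ t ∈ Icc 0 π, ‖f t‖ ≤ c * (t ^ n / n.factorial)) {t : ℝ}
    (ht : t ∈ Icc 0 π) :
    ‖∫ τ in (0 : ℝ)..t, w τ * f (σ τ)‖ ≤ W * c * (t ^ (n + 1) / (n + 1).factorial) := by
  have hmono : MonotoneOn (fun t : ℝ => c * (t ^ n / n.factorial)) (Icc 0 π) := by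
    intro x hx y hy hxy
    have := hx.1
    dsimp only
    gcongr
  have h1 : ∀ τ ∈ Icc 0 t \ S, ‖w τ * f (σ τ)‖ ≤ W * (c * (τ ^ n / n.factorial)) :=
    fun τ hτ => h.norm_mul_comp_le hmono hfn ⟨⟨hτ.1.1, hτ.1.2.trans ht.2⟩, hτ.2⟩
  refine (norm_integral_le_of_norm_le_off_finite h.finite ht.1 h1
    (Continuous.intervalIntegrable (by fun_prop) _ _)).trans_eq ?_
  rw [intervalIntegral.integral_const_mul, intervalIntegral.integral_const_mul,
    intervalIntegral.integral_div, integral_pow, Nat.factorial_succ]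
  push_cast
  field_simp
  simp

theorem continuousOn_primitive (h : IsRetardedKernel w σ S W) {f : ℝ → ℂ} (hf : Continuous f) :
    ContinuousOn (fun t => ∫ τ in (0 : ℝ)..t, w τ * f (σ τ)) (Icc 0 π) := by
  have h0 : (0 : ℝ) ∈ Icc 0 π := ⟨le_rfl, pi_pos.le⟩
  have hπ : π ∈ Icc 0 π := ⟨pi_pos.le, le_rfl⟩
  have := intervalIntegral.continuousOn_primitive_interval
    ((intervalIntegrable_iff' enorm_ne_top).1 (h.intervalIntegrable hf h0 hπ))
  rwa [uIcc_of_le pi_pos.le] at this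

theorem continuous_primitive (h : IsRetardedKernel w σ S W) {f : ℝ → ℂ} (hf : Continuous f) :
    Continuous fun t : Icc (0 : ℝ) π => ∫ τ in (0 : ℝ)..t, w τ * f (σ τ) :=
  continuousOn_iff_continuous_domRestrict.1 (h.continuousOn_primitive hf)

theorem hasDerivWithinAt_primitive (h : IsRetardedKernel w σ S W) {f : ℝ → ℂ} (hf : Continuous f)
    {t : ℝ} (ht : t ∈ Icc 0 π \ S) :
    HasDerivWithinAt (fun t => ∫ τ in (0 : ℝ)..t, w τ * f (σ τ)) (w t * f (σ t)) (Icc 0 π) t := by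
  have h0 : (0 : ℝ) ∈ Icc 0 π := ⟨le_rfl, pi_pos.le⟩
  have hπ : π ∈ Icc 0 π := ⟨pi_pos.le, le_rfl⟩
  have : Fact (t ∈ Icc 0 π) := ⟨ht.1⟩
  have hc : ContinuousWithinAt (fun τ => w τ * f (σ τ)) (Icc 0 π) t := by
    refine (h.continuousOn_mul_comp hf t ht).mono_of_mem_nhdsWithin ?_
    rw [sdiff_eq]
    exact inter_mem self_mem_nhdsWithin
      (mem_nhdsWithin_of_mem_nhds (h.finite.isClosed.isOpen_compl.mem_nhds ht.2))
  refine intervalIntegral.integral_hasDerivWithinAt_right (h.intervalIntegrable hf h0 ht.1) ?_ hc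
  refine ⟨Icc 0 π, self_mem_nhdsWithin, ?_⟩
  have := (intervalIntegrable_iff' enorm_ne_top).1 (h.intervalIntegrable hf h0 hπ)
  rw [uIcc_of_le pi_pos.le] at this
  exact this.aestronglyMeasurable

/-- The operator `f ↦ (t ↦ ∫ τ in 0..t, w τ * f (σ τ))` on `C([0, π])`. -/
noncomputable def primitive (h : IsRetardedKernel w σ S W) :
    C(Icc (0 : ℝ) π, ℂ) →L[ℂ] C(Icc (0 : ℝ) π, ℂ) :=
  LinearMap.mkContinuous
    { toFun := fun f => ⟨fun t => ∫ τ in (0 : ℝ)..t, w τ * IccExtend pi_pos.le f (σ τ),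
        h.continuous_primitive f.continuous.Icc_extend'⟩
      map_add' := fun f g => by
        ext t
        have h0 : (0 : ℝ) ∈ Icc 0 π := ⟨le_rfl, pi_pos.le⟩
        simp only [ContinuousMap.coe_mk, ContinuousMap.add_apply]
        rw [← intervalIntegral.integral_add (h.intervalIntegrable f.continuous.Icc_extend' h0 t.2)
          (h.intervalIntegrable g.continuous.Icc_extend' h0 t.2)]
        refine intervalIntegral.integral_congr fun τ _ => ?_
        simp [IccExtend, mul_add]
      map_smul' := fun c f => by
        ext t
        simp only [ContinuousMap.coe_mk, ContinuousMap.smul_apply, RingHom.id_apply, smul_eq_mul]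
        rw [← intervalIntegral.integral_const_mul]
        refine intervalIntegral.integral_congr fun τ _ => ?_
        simp [IccExtend, mul_left_comm] }
    (W * π) (fun f => by
      have hW := h.bound_nonneg
      refine (ContinuousMap.norm_le _ (by positivity)).2 fun t => ?_
      have h1 := h.norm_integral_le_pow (f := IccExtend pi_pos.le f) (norm_nonneg f) (n := 0)
        (fun s _ => by simpa [IccExtend] using f.norm_coe_le_norm _) t.2
      simp only [LinearMap.coe_mk, AddHom.coe_mk, ContinuousMap.coe_mk]
      refine h1.trans ?_
      simp only [zero_add, pow_one, Nat.factorial_one, Nat.cast_one, div_one]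
      calc W * ‖f‖ * (t : ℝ) ≤ W * ‖f‖ * π := by
            gcongr
            exact t.2.2
        _ = _ := by ring)

theorem primitive_apply (h : IsRetardedKernel w σ S W) (f : C(Icc (0 : ℝ) π, ℂ))
    (t : Icc (0 : ℝ) π) :
    h.primitive f t = ∫ τ in (0 : ℝ)..t, w τ * IccExtend pi_pos.le f (σ τ) := rfl

theorem norm_primitive_apply_le (h : IsRetardedKernel w σ S W) {f : C(Icc (0 : ℝ) π, ℂ)} {c : ℝ}
    (hc : 0 ≤ c) {n : ℕ} (hf : ∀ t, ‖f t‖ ≤ c * ((t : ℝ) ^ n / n.factorial))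
    (t : Icc (0 : ℝ) π) :
    ‖h.primitive f t‖ ≤ W * c * ((t : ℝ) ^ (n + 1) / (n + 1).factorial) := by
  rw [primitive_apply]
  refine h.norm_integral_le_pow hc (fun s hs => ?_) t.2
  rw [IccExtend_of_mem _ _ hs]
  exact hf ⟨s, hs⟩

/-- The Volterra operator `f ↦ ∫∫ (w * f ∘ σ + μ ^ 2 * f)`. -/
noncomputable def volterra (h : IsRetardedKernel w σ S W) (μ : ℂ) :
    C(Icc (0 : ℝ) π, ℂ) →L[ℂ] C(Icc (0 : ℝ) π, ℂ) :=
  isRetardedKernel_one.primitive * (h.primitive + μ ^ 2 • isRetardedKernel_one.primitive)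

theorem norm_volterra_apply_le (h : IsRetardedKernel w σ S W) (μ : ℂ) {f : C(Icc (0 : ℝ) π, ℂ)}
    {c : ℝ} (hc : 0 ≤ c) {n : ℕ} (hf : ∀ t, ‖f t‖ ≤ c * ((t : ℝ) ^ n / n.factorial))
    (t : Icc (0 : ℝ) π) :
    ‖h.volterra μ f t‖ ≤ (W + ‖μ‖ ^ 2) * c * ((t : ℝ) ^ (n + 2) / (n + 2).factorial) := by
  have hW := h.bound_nonneg
  have h1 : ∀ t, ‖(h.primitive + μ ^ 2 • isRetardedKernel_one.primitive) f t‖ ≤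
      ((W + ‖μ‖ ^ 2) * c) * ((t : ℝ) ^ (n + 1) / (n + 1).factorial) := by
    intro t
    have h2 := h.norm_primitive_apply_le hc hf t
    have h3 := isRetardedKernel_one.norm_primitive_apply_le hc hf t
    simp only [add_apply, smul_apply,
      ContinuousMap.add_apply, ContinuousMap.smul_apply, smul_eq_mul]
    refine (norm_add_le _ _).trans ?_
    rw [norm_mul, norm_pow]
    calc _ ≤ W * c * ((t : ℝ) ^ (n + 1) / (n + 1).factorial)
          + ‖μ‖ ^ 2 * (1 * c * ((t : ℝ) ^ (n + 1) / (n + 1).factorial)) := by gcongr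
      _ = _ := by ring
  have h4 := isRetardedKernel_one.norm_primitive_apply_le (by positivity) h1 t
  rwa [one_mul] at h4

/-- Each application integrates twice, raising the exponent in `t ^ k / k!` by two. -/
theorem norm_volterra_pow_apply_le (h : IsRetardedKernel w σ S W) (μ : ℂ)
    (f : C(Icc (0 : ℝ) π, ℂ)) (n : ℕ) (t : Icc (0 : ℝ) π) :
    ‖(h.volterra μ ^ n) f t‖ ≤
      (W + ‖μ‖ ^ 2) ^ n * ‖f‖ * ((t : ℝ) ^ (2 * n) / (2 * n).factorial) := by
  have hW := h.bound_nonneg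
  induction n generalizing t with
  | zero => simpa using f.norm_coe_le_norm t
  | succ n ih =>
    have := h.norm_volterra_apply_le μ (by positivity) ih t
    rw [pow_succ' (h.volterra μ), mul_apply_eq_comp]
    calc _ ≤ _ := this
      _ = _ := by
        rw [show 2 * (n + 1) = 2 * n + 2 by ring]
        ring

theorem exists_norm_volterra_pow_lt_one (h : IsRetardedKernel w σ S W) (μ : ℂ) :
    ∃ n, ‖h.volterra μ ^ n‖ < 1 := by
  have hW := h.bound_nonneg
  have hlim := FloorSemiring.tendsto_pow_div_factorial_atTop ((W + ‖μ‖ ^ 2) * π ^ 2)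
  obtain ⟨n, hn⟩ := (hlim.eventually_lt_const one_pos).exists
  refine ⟨n, lt_of_le_of_lt (ContinuousLinearMap.opNorm_le_bound _ (by positivity) fun f => ?_) hn⟩
  refine (ContinuousMap.norm_le _ (by positivity)).2 fun t => ?_
  refine (h.norm_volterra_pow_apply_le μ f n t).trans ?_
  have ht := t.2.1
  -- Giving away the stronger decay of `1 / (2 n)!` leaves `x ^ n / n!`, which already tends to 0.
  have h1 : (n.factorial : ℝ) ≤ ((2 * n).factorial : ℝ) := by
    exact_mod_cast Nat.factorial_le (by omega)
  have h2 : (t : ℝ) ^ (2 * n) ≤ π ^ (2 * n) := by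
    gcongr
    exact t.2.2
  calc _ ≤ (W + ‖μ‖ ^ 2) ^ n * ‖f‖ * (π ^ (2 * n) / n.factorial) := by gcongr
    _ = _ := by
      rw [mul_pow, ← pow_mul]
      ring

theorem isUnit_one_add_volterra (h : IsRetardedKernel w σ S W) (μ : ℂ) :
    IsUnit (1 + h.volterra μ) := by
  obtain ⟨n, hn⟩ := h.exists_norm_volterra_pow_lt_one μ
  exact isUnit_one_add_of_norm_pow_lt_one (R := C(Icc (0 : ℝ) π, ℂ) →L[ℂ] C(Icc (0 : ℝ) π, ℂ)) hn

/-- The solution with initial values `a`, `b` of the integral equation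
`y t = a + b t - ∫∫ (w * y ∘ σ + μ ^ 2 * y)`. -/
noncomputable def sol (h : IsRetardedKernel w σ S W) (μ a b : ℂ) : C(Icc (0 : ℝ) π, ℂ) :=
  Ring.inverse (1 + h.volterra μ) (a • 1 + b • isRetardedKernel_one.primitive 1)

/-- The derivative of `sol`. -/
noncomputable def solDeriv (h : IsRetardedKernel w σ S W) (μ a b : ℂ) : C(Icc (0 : ℝ) π, ℂ) :=
  b • 1 - (h.primitive + μ ^ 2 • isRetardedKernel_one.primitive) (h.sol μ a b)

theorem sol_eq (h : IsRetardedKernel w σ S W) (μ a b : ℂ) :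
    h.sol μ a b = a • 1 + isRetardedKernel_one.primitive (h.solDeriv μ a b) := by
  have h1 : (1 + h.volterra μ) (h.sol μ a b) = a • 1 + b • isRetardedKernel_one.primitive 1 := by
    rw [sol, ← mul_apply_eq_comp,
      Ring.mul_inverse_cancel _ (h.isUnit_one_add_volterra μ), one_apply_eq_self]
  rw [solDeriv, map_sub, map_smul]
  rw [add_apply, one_apply_eq_self, ← eq_sub_iff_add_eq] at h1
  refine h1.trans ?_
  rw [volterra, mul_apply_eq_comp, add_sub_assoc]

/-- Inversion is differentiable at units and the operator is a polynomial in `μ`, so the solution is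
entire as a function with values in `C([0, π])`. -/
theorem differentiable_sol (h : IsRetardedKernel w σ S W) {a b : ℂ → ℂ} (ha : Differentiable ℂ a)
    (hb : Differentiable ℂ b) : Differentiable ℂ fun μ => h.sol μ (a μ) (b μ) := by
  have hv : Differentiable ℂ fun μ => Ring.inverse (1 + h.volterra μ) := by
    intro μ
    refine DifferentiableAt.inverse (𝕜 := ℂ) (h := fun μ => 1 + h.volterra μ) ?_
      (h.isUnit_one_add_volterra μ)
    have h1 : (fun μ => 1 + h.volterra μ) = fun μ =>
        (1 + isRetardedKernel_one.primitive * h.primitive) +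
          μ ^ 2 • (isRetardedKernel_one.primitive * isRetardedKernel_one.primitive) := by
      ext1 μ
      refine ContinuousLinearMap.ext fun f => ?_
      simp only [volterra, add_apply, smul_apply, mul_apply_eq_comp, map_add, map_smul, add_assoc]
    rw [h1]
    exact differentiable_add_sq_smul (E := C(Icc (0 : ℝ) π, ℂ) →L[ℂ] C(Icc (0 : ℝ) π, ℂ)) _ _ μ
  unfold sol
  fun_prop

theorem differentiable_solDeriv (h : IsRetardedKernel w σ S W) {a b : ℂ → ℂ}
    (ha : Differentiable ℂ a) (hb : Differentiable ℂ b) :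
    Differentiable ℂ fun μ => h.solDeriv μ (a μ) (b μ) := by
  have := h.differentiable_sol ha hb
  unfold solDeriv
  fun_prop

end IsRetardedKernel

/-- `y`, with derivative `dy`, solves `y'' + w * y ∘ σ + μ ^ 2 * y = 0` on `[0, π] \ S`, and is
`C¹` on `[0, π]`. -/
structure IsRetardedSol (w : ℝ → ℂ) (σ : ℝ → ℝ) (S : Set ℝ) (μ : ℂ) (y dy : ℝ → ℂ) : Prop where
  continuous : Continuous y
  continuous_deriv : Continuous dy
  hasDeriv : ∀ t ∈ Icc 0 π, HasDerivWithinAt y (dy t) (Icc 0 π) t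
  equation : ∀ t ∈ Icc 0 π \ S,
    HasDerivWithinAt dy (-(w t * y (σ t)) - μ ^ 2 * y t) (Icc 0 π) t

/-- The solution of the integral equation is extended by constants outside `[0, π]`, which makes it
continuous on the line; evaluation at a point is continuous and linear, so analyticity in `μ` passes
to the values. -/
theorem IsRetardedKernel.exists_isRetardedSol {w : ℝ → ℂ} {σ : ℝ → ℝ} {S : Set ℝ} {W : ℝ}
    (h : IsRetardedKernel w σ S W) {a b : ℂ → ℂ} (ha : Differentiable ℂ a)
    (hb : Differentiable ℂ b) :
    ∃ y dy : ℂ → ℝ → ℂ,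
      (∀ μ, IsRetardedSol w σ S μ (y μ) (dy μ) ∧ y μ 0 = a μ ∧ dy μ 0 = b μ) ∧
      (∀ t, Differentiable ℂ fun μ => y μ t) ∧ ∀ t, Differentiable ℂ fun μ => dy μ t := by
  refine ⟨fun μ => IccExtend pi_pos.le (h.sol μ (a μ) (b μ)),
    fun μ => IccExtend pi_pos.le (h.solDeriv μ (a μ) (b μ)), fun μ => ?_, fun t => ?_, fun t => ?_⟩
  · set f := h.sol μ (a μ) (b μ) with hf
    set g := h.solDeriv μ (a μ) (b μ) with hg
    have hfc : Continuous (IccExtend pi_pos.le f) := f.continuous.Icc_extend'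
    have hgc : Continuous (IccExtend pi_pos.le g) := g.continuous.Icc_extend'
    have hfe : ∀ t ∈ Icc 0 π, IccExtend pi_pos.le f t =
        a μ + ∫ τ in (0 : ℝ)..t, IccExtend pi_pos.le g τ := by
      intro t ht
      rw [IccExtend_of_mem _ _ ht, hf, h.sol_eq, ← hg, ContinuousMap.add_apply,
        IsRetardedKernel.primitive_apply]
      simp
    have hge : ∀ t ∈ Icc 0 π, IccExtend pi_pos.le g t =
        b μ - (∫ τ in (0 : ℝ)..t, w τ * IccExtend pi_pos.le f (σ τ))
          - μ ^ 2 * ∫ τ in (0 : ℝ)..t, IccExtend pi_pos.le f τ := by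
      intro t ht
      rw [IccExtend_of_mem _ _ ht, hg, IsRetardedKernel.solDeriv, ← hf]
      simp [IsRetardedKernel.primitive_apply, sub_sub]
    have h0 : (0 : ℝ) ∈ Icc 0 π := ⟨le_rfl, pi_pos.le⟩
    refine ⟨⟨hfc, hgc, fun t ht => ?_, fun t ht => ?_⟩, ?_, ?_⟩
    · have h1 : HasDerivAt (fun t => a μ + ∫ τ in (0 : ℝ)..t, IccExtend pi_pos.le g τ)
          (IccExtend pi_pos.le g t) t := by
        simpa using (intervalIntegral.integral_hasDerivAt_right (hgc.intervalIntegrable 0 t)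
          (hgc.stronglyMeasurableAtFilter _ _) hgc.continuousAt).const_add (a μ)
      exact h1.hasDerivWithinAt.congr hfe (hfe t ht)
    · have h1 := h.hasDerivWithinAt_primitive hfc ht
      have h2 : HasDerivAt (fun t => ∫ τ in (0 : ℝ)..t, IccExtend pi_pos.le f τ)
          (IccExtend pi_pos.le f t) t :=
        intervalIntegral.integral_hasDerivAt_right (hfc.intervalIntegrable 0 t)
          (hfc.stronglyMeasurableAtFilter _ _) hfc.continuousAt
      have h3 := ((h1.const_sub (b μ)).sub (h2.hasDerivWithinAt.const_mul (μ ^ 2)))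
      exact h3.congr hge (hge t ht.1)
    · refine (hfe 0 h0).trans ?_
      simp
    · refine (hge 0 h0).trans ?_
      simp
  · have h1 := h.differentiable_sol ha hb
    have h2 : ∀ μ, IccExtend pi_pos.le (h.sol μ (a μ) (b μ)) t =
        ContinuousMap.evalCLM ℂ (projIcc 0 π pi_pos.le t) (h.sol μ (a μ) (b μ)) := fun μ => rfl
    simp only [h2]
    fun_prop
  · have h1 := h.differentiable_solDeriv ha hb
    have h2 : ∀ μ, IccExtend pi_pos.le (h.solDeriv μ (a μ) (b μ)) t =
        ContinuousMap.evalCLM ℂ (projIcc 0 π pi_pos.le t) (h.solDeriv μ (a μ) (b μ)) :=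
      fun μ => rfl
    simp only [h2]
    fun_prop

/-! ### Asymptotics of solutions of retarded equations -/

theorem norm_csin_mul_ofReal_le (μ : ℂ) {t : ℝ} (ht : 0 ≤ t) :
    ‖Complex.sin (μ * t)‖ ≤ exp (|μ.im| * t) := by
  have := norm_csin_le_exp_abs_im (μ * t)
  rwa [Complex.im_mul_ofReal, abs_mul, abs_of_nonneg ht] at this

theorem norm_ccos_mul_ofReal_le (μ : ℂ) {t : ℝ} (ht : 0 ≤ t) :
    ‖Complex.cos (μ * t)‖ ≤ exp (|μ.im| * t) := by
  have := norm_ccos_le_exp_abs_im (μ * t)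
  rwa [Complex.im_mul_ofReal, abs_mul, abs_of_nonneg ht] at this

/-- Mean value inequality on the convex strip `|Im z| ≤ 1`, where every sine or cosine involved is
at most `exp π`. -/
theorem norm_ccos_mul_ccos_sub_le {s t : ℝ} (hs : s ∈ Icc 0 π) (ht : t ∈ Icc 0 π) {z w : ℂ}
    (hz : |z.im| ≤ 1) (hw : |w.im| ≤ 1) :
    ‖Complex.cos (z * s) * Complex.cos (z * t) - Complex.cos (w * s) * Complex.cos (w * t)‖
      ≤ 2 * π * exp (2 * π) * ‖z - w‖ := by
  have hconv : Convex ℝ {z : ℂ | |z.im| ≤ 1} := by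
    have : {z : ℂ | |z.im| ≤ 1} = Complex.imLm ⁻¹' Icc (-1) 1 := by
      ext z
      simp [abs_le]
    rw [this]
    exact (convex_Icc _ _).linear_preimage _
  have hd : ∀ x ∈ {z : ℂ | |z.im| ≤ 1},
      HasDerivWithinAt (fun z : ℂ => Complex.cos (z * s) * Complex.cos (z * t))
      (-Complex.sin (x * s) * s * Complex.cos (x * t)
        + Complex.cos (x * s) * (-Complex.sin (x * t) * t)) {z : ℂ | |z.im| ≤ 1} x := by
    intro x _
    have h1 := ((hasDerivAt_id x).mul_const (s : ℂ)).ccos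
    have h2 := ((hasDerivAt_id x).mul_const (t : ℂ)).ccos
    simpa using (h1.fun_mul h2).hasDerivWithinAt
  refine hconv.norm_image_sub_le_of_norm_hasDerivWithin_le hd (fun x hx => ?_) hw hz
  have hb : ∀ u ∈ Icc 0 π, exp (|x.im| * u) ≤ exp π := by
    intro u hu
    apply exp_le_exp.2
    have : |x.im| ≤ 1 := hx
    nlinarith [hu.1, hu.2, abs_nonneg x.im]
  have h1 := (norm_csin_mul_ofReal_le x hs.1).trans (hb s hs)
  have h2 := (norm_csin_mul_ofReal_le x ht.1).trans (hb t ht)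
  have h3 := (norm_ccos_mul_ofReal_le x hs.1).trans (hb s hs)
  have h4 := (norm_ccos_mul_ofReal_le x ht.1).trans (hb t ht)
  refine (norm_add_le _ _).trans ?_
  simp only [norm_mul, norm_neg, Complex.norm_real, Real.norm_of_nonneg hs.1,
    Real.norm_of_nonneg ht.1]
  have hs' := hs.1
  have ht' := ht.1
  calc _ ≤ exp π * π * exp π + exp π * (exp π * π) := by
        gcongr
        · exact hs.2
        · exact ht.2
    _ = _ := by
      rw [two_mul π, Real.exp_add]
      ring

theorem norm_csin_sub_csin_le {z w : ℂ} (hz : |z.im| ≤ 1) (hw : |w.im| ≤ 1) :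
    ‖Complex.sin (z * π) - Complex.sin (w * π)‖ ≤ 2 * π * exp (2 * π) * ‖z - w‖ := by
  have hconv : Convex ℝ {z : ℂ | |z.im| ≤ 1} := by
    have : {z : ℂ | |z.im| ≤ 1} = Complex.imLm ⁻¹' Icc (-1) 1 := by
      ext z
      simp [abs_le]
    rw [this]
    exact (convex_Icc _ _).linear_preimage _
  have hd : ∀ x ∈ {z : ℂ | |z.im| ≤ 1}, HasDerivWithinAt (fun z : ℂ => Complex.sin (z * π))
      (Complex.cos (x * π) * π) {z : ℂ | |z.im| ≤ 1} x := by
    intro x _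
    simpa using (((hasDerivAt_id x).mul_const (π : ℂ)).csin).hasDerivWithinAt
  refine hconv.norm_image_sub_le_of_norm_hasDerivWithin_le hd (fun x hx => ?_) hw hz
  have hx' : |x.im| ≤ 1 := hx
  rw [norm_mul, Complex.norm_real, Real.norm_of_nonneg pi_pos.le]
  calc _ ≤ exp (2 * π) * π := by
        gcongr
        refine (norm_ccos_mul_ofReal_le x pi_pos.le).trans (exp_le_exp.2 ?_)
        nlinarith [pi_pos]
    _ ≤ _ := by nlinarith [pi_pos, exp_pos (2 * π)]

theorem hasDerivAt_csin_mul_sub (μ : ℂ) (t τ : ℝ) :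
    HasDerivAt (fun τ : ℝ => Complex.sin (μ * (t - τ : ℝ)))
      (-(μ * Complex.cos (μ * (t - τ : ℝ)))) τ := by
  have h3 : HasDerivAt (fun τ : ℝ => μ * ((t - τ : ℝ) : ℂ)) (μ * ((-1 : ℝ) : ℂ)) τ :=
    (((hasDerivAt_id τ).const_sub t).ofReal_comp).const_mul μ
  refine ((Complex.hasDerivAt_sin _).comp τ h3).congr_deriv ?_
  push_cast
  ring

theorem hasDerivAt_ccos_mul_sub (μ : ℂ) (t τ : ℝ) :
    HasDerivAt (fun τ : ℝ => Complex.cos (μ * (t - τ : ℝ)))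
      (μ * Complex.sin (μ * (t - τ : ℝ))) τ := by
  have h3 : HasDerivAt (fun τ : ℝ => μ * ((t - τ : ℝ) : ℂ)) (μ * ((-1 : ℝ) : ℂ)) τ :=
    (((hasDerivAt_id τ).const_sub t).ofReal_comp).const_mul μ
  refine ((Complex.hasDerivAt_cos _).comp τ h3).congr_deriv ?_
  push_cast
  ring

namespace IsRetardedSol

variable {w : ℝ → ℂ} {σ : ℝ → ℝ} {S : Set ℝ} {W : ℝ} {μ : ℂ} {y dy : ℝ → ℂ}

theorem hasDerivAt_pair (hy : IsRetardedSol w σ S μ y dy) {t : ℝ} (ht : t ∈ Ioo 0 π \ S) :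
    HasDerivAt y (dy t) t ∧ HasDerivAt dy (-(w t * y (σ t)) - μ ^ 2 * y t) t := by
  have hn := Icc_mem_nhds ht.1.1 ht.1.2
  exact ⟨(hy.hasDeriv t (Ioo_subset_Icc_self ht.1)).hasDerivAt hn,
    (hy.equation t ⟨Ioo_subset_Icc_self ht.1, ht.2⟩).hasDerivAt hn⟩

/-- The integral equation with sine kernel. -/
theorem mul_eq (h : IsRetardedKernel w σ S W) (hy : IsRetardedSol w σ S μ y dy) {t : ℝ}
    (ht : t ∈ Icc 0 π) :
    μ * y t = μ * y 0 * Complex.cos (μ * t) + dy 0 * Complex.sin (μ * t) -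
      ∫ τ in (0 : ℝ)..t, w τ * y (σ τ) * Complex.sin (μ * (t - τ : ℝ)) := by
  have hc := hy.continuous
  have hc' := hy.continuous_deriv
  -- In the derivative of this combination the terms with `dy` and with `μ ^ 2 * y` cancel, and only
  -- the retarded term survives. The equation may fail on the finite set `S`. Keeping the factor `μ`
  -- avoids excluding `μ = 0`.
  have key := MeasureTheory.integral_eq_of_hasDerivAt_off_countable
    (fun τ : ℝ => dy τ * Complex.sin (μ * (t - τ : ℝ)) + μ * y τ * Complex.cos (μ * (t - τ : ℝ)))
    (fun τ => -(w τ * y (σ τ) * Complex.sin (μ * (t - τ : ℝ)))) (a := 0) (b := t)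
    h.finite.countable (by fun_prop) (fun τ hτ => ?_)
    (h.intervalIntegrable_mul hc (by fun_prop) ⟨le_rfl, pi_pos.le⟩ ht).neg
  · rw [intervalIntegral.integral_neg] at key
    simp only [sub_self, Complex.ofReal_zero, mul_zero, Complex.sin_zero, Complex.cos_zero,
      sub_zero, mul_one, zero_add] at key
    linear_combination -key
  · rw [min_eq_left ht.1, max_eq_right ht.1] at hτ
    obtain ⟨h1, h2⟩ := hy.hasDerivAt_pair (t := τ) ⟨⟨hτ.1.1, hτ.1.2.trans_le ht.2⟩, hτ.2⟩
    refine ((h2.fun_mul (hasDerivAt_csin_mul_sub μ t τ)).fun_add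
      ((h1.const_mul μ).fun_mul (hasDerivAt_ccos_mul_sub μ t τ))).congr_deriv ?_
    ring

/-- The integral equation with cosine kernel for the derivative. -/
theorem deriv_eq (h : IsRetardedKernel w σ S W) (hy : IsRetardedSol w σ S μ y dy) {t : ℝ}
    (ht : t ∈ Icc 0 π) :
    dy t = dy 0 * Complex.cos (μ * t) - μ * y 0 * Complex.sin (μ * t) -
      ∫ τ in (0 : ℝ)..t, w τ * y (σ τ) * Complex.cos (μ * (t - τ : ℝ)) := by
  have hc := hy.continuous
  have hc' := hy.continuous_deriv
  have key := MeasureTheory.integral_eq_of_hasDerivAt_off_countable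
    (fun τ : ℝ => dy τ * Complex.cos (μ * (t - τ : ℝ)) - μ * y τ * Complex.sin (μ * (t - τ : ℝ)))
    (fun τ => -(w τ * y (σ τ) * Complex.cos (μ * (t - τ : ℝ)))) (a := 0) (b := t)
    h.finite.countable (by fun_prop) (fun τ hτ => ?_)
    (h.intervalIntegrable_mul hc (by fun_prop) ⟨le_rfl, pi_pos.le⟩ ht).neg
  · rw [intervalIntegral.integral_neg] at key
    simp only [sub_self, Complex.ofReal_zero, mul_zero, Complex.sin_zero, Complex.cos_zero,
      sub_zero, mul_one] at key
    linear_combination -key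
  · rw [min_eq_left ht.1, max_eq_right ht.1] at hτ
    obtain ⟨h1, h2⟩ := hy.hasDerivAt_pair (t := τ) ⟨⟨hτ.1.1, hτ.1.2.trans_le ht.2⟩, hτ.2⟩
    refine ((h2.fun_mul (hasDerivAt_ccos_mul_sub μ t τ)).fun_sub
      ((h1.const_mul μ).fun_mul (hasDerivAt_csin_mul_sub μ t τ))).congr_deriv ?_
    ring

end IsRetardedSol

/-! ### A priori bounds and expansions for large spectral parameter -/

namespace IsRetardedKernel

variable {w : ℝ → ℂ} {σ : ℝ → ℝ} {S : Set ℝ} {W : ℝ}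

/-- Since `exp (ν τ) * exp (ν (t - τ)) = exp (ν t)`, convolution with a sine or cosine kernel
preserves the exponential growth rate. -/
theorem norm_integral_mul_le_exp (h : IsRetardedKernel w σ S W) {f k : ℝ → ℂ} {M ν t : ℝ}
    (hν : 0 ≤ ν) (hM : 0 ≤ M) (ht : t ∈ Icc 0 π)
    (hf : ∀ s ∈ Icc 0 π, ‖f s‖ ≤ M * exp (ν * s))
    (hk : ∀ τ ∈ Icc 0 t, ‖k τ‖ ≤ exp (ν * (t - τ))) :
    ‖∫ τ in (0 : ℝ)..t, w τ * f (σ τ) * k τ‖ ≤ W * π * M * exp (ν * t) := by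
  have hmono : MonotoneOn (fun s => M * exp (ν * s)) (Icc 0 π) := by
    intro x _ y _ hxy
    dsimp only
    gcongr
  have hW := h.bound_nonneg
  have h1 : ∀ τ ∈ Icc 0 t \ S, ‖w τ * f (σ τ) * k τ‖ ≤ W * M * exp (ν * t) := by
    intro τ hτ
    rw [norm_mul]
    have h2 := h.norm_mul_comp_le hmono hf (t := τ) ⟨⟨hτ.1.1, hτ.1.2.trans ht.2⟩, hτ.2⟩
    calc _ ≤ W * (M * exp (ν * τ)) * exp (ν * (t - τ)) := by
          gcongr
          exact hk τ hτ.1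
      _ = W * M * (exp (ν * τ) * exp (ν * (t - τ))) := by ring
      _ = _ := by
        rw [← Real.exp_add]
        congr 2
        ring
  refine (norm_integral_le_of_norm_le_off_finite h.finite ht.1 h1
    intervalIntegrable_const).trans ?_
  rw [intervalIntegral.integral_const, sub_zero, smul_eq_mul]
  calc _ ≤ π * (W * M * exp (ν * t)) := by
        gcongr
        exact ht.2
    _ = _ := by ring

/-- At a maximum `M` of `‖y t‖ exp (-|Im μ| t)` the integral equation bounds `‖μ‖ * M` by the
initial data plus `W π M`; for `‖μ‖ ≥ 2 W π` the last term is absorbed on the left. -/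
theorem norm_mul_sol_le (h : IsRetardedKernel w σ S W) {μ : ℂ} {y dy : ℝ → ℂ}
    (hy : IsRetardedSol w σ S μ y dy) (hμ : 2 * (W * π) ≤ ‖μ‖) (hμ0 : 0 < ‖μ‖) {t : ℝ}
    (ht : t ∈ Icc 0 π) :
    ‖y t‖ ≤ 2 * (‖y 0‖ + ‖dy 0‖ / ‖μ‖) * exp (|μ.im| * t) := by
  obtain ⟨t₀, ht₀, hmax⟩ := isCompact_Icc.exists_isMaxOn (s := Icc 0 π)
    (f := fun t => ‖y t‖ * exp (-(|μ.im| * t))) ⟨0, le_rfl, pi_pos.le⟩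
    (hy.continuous.norm.mul (by fun_prop)).continuousOn
  set M := ‖y t₀‖ * exp (-(|μ.im| * t₀)) with hM
  have hM0 : 0 ≤ M := by positivity
  have hyM : ∀ s ∈ Icc 0 π, ‖y s‖ ≤ M * exp (|μ.im| * s) := by
    intro s hs
    have h1 : ‖y s‖ * exp (-(|μ.im| * s)) ≤ M := hmax hs
    rwa [Real.exp_neg, ← div_eq_mul_inv, div_le_iff₀ (exp_pos _)] at h1
  have h1 : ‖μ‖ * ‖y t₀‖ ≤
      (‖μ‖ * ‖y 0‖ + ‖dy 0‖ + W * π * M) * exp (|μ.im| * t₀) := by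
    rw [← norm_mul, hy.mul_eq h ht₀]
    have h2 := h.norm_integral_mul_le_exp (f := y)
      (k := fun τ => Complex.sin (μ * (t₀ - τ : ℝ))) (abs_nonneg μ.im) hM0 ht₀ hyM
      (fun τ hτ => norm_csin_mul_ofReal_le μ (sub_nonneg.2 hτ.2))
    have h3 := norm_csin_mul_ofReal_le μ ht₀.1
    have h4 := norm_ccos_mul_ofReal_le μ ht₀.1
    calc _ ≤ ‖μ‖ * ‖y 0‖ * ‖Complex.cos (μ * t₀)‖ + ‖dy 0‖ * ‖Complex.sin (μ * t₀)‖
          + W * π * M * exp (|μ.im| * t₀) := by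
          refine (norm_sub_le _ _).trans (add_le_add ((norm_add_le _ _).trans_eq ?_) h2)
          simp only [norm_mul]
      _ ≤ ‖μ‖ * ‖y 0‖ * exp (|μ.im| * t₀) + ‖dy 0‖ * exp (|μ.im| * t₀)
          + W * π * M * exp (|μ.im| * t₀) := by gcongr
      _ = _ := by ring
  have h2 : ‖μ‖ * M ≤ ‖μ‖ * ‖y 0‖ + ‖dy 0‖ + W * π * M := by
    rw [hM, Real.exp_neg, ← div_eq_mul_inv, mul_div_assoc', div_le_iff₀ (exp_pos _),
      div_eq_mul_inv, ← Real.exp_neg, ← hM]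
    exact h1
  have h3 : M ≤ 2 * (‖y 0‖ + ‖dy 0‖ / ‖μ‖) := by
    have h4 : ‖μ‖ * M ≤ ‖μ‖ * (2 * (‖y 0‖ + ‖dy 0‖ / ‖μ‖)) := by
      have h5 : ‖μ‖ * (2 * (‖y 0‖ + ‖dy 0‖ / ‖μ‖)) = 2 * (‖μ‖ * ‖y 0‖ + ‖dy 0‖) := by
        field_simp
      rw [h5]
      nlinarith
    exact le_of_mul_le_mul_left h4 hμ0
  exact (hyM t ht).trans (by gcongr)

end IsRetardedKernel

/-- The integral `∫ w τ * cos (μ * σ τ) * cos (μ * (π - τ))` over `[0, π]`. -/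
noncomputable def retardedCosIntegral (w : ℝ → ℂ) (σ : ℝ → ℝ) (μ : ℂ) : ℂ :=
  ∫ τ in (0 : ℝ)..π, w τ * Complex.cos (μ * σ τ) * Complex.cos (μ * (π - τ : ℝ))

/-- The coefficient of `μ ^ 2` in the expansion of the characteristic function. -/
noncomputable def secondOrderTerm (w : ℝ → ℂ) (σ : ℝ → ℝ) (a a' b c d d' : ℂ) (μ : ℂ) : ℂ :=
  (c * a - d * b) * Complex.cos (μ * π) + (d * a' + d' * a) * Complex.sin (μ * π)
    + d * a * retardedCosIntegral w σ μ

namespace IsRetardedKernel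

variable {w : ℝ → ℂ} {σ : ℝ → ℝ} {S : Set ℝ} {W : ℝ}

theorem norm_retardedCosIntegral_le (h : IsRetardedKernel w σ S W) (μ : ℂ) :
    ‖retardedCosIntegral w σ μ‖ ≤ W * π * exp (|μ.im| * π) := by
  have := h.norm_integral_mul_le_exp (f := fun s => Complex.cos (μ * s))
    (k := fun τ => Complex.cos (μ * (π - τ : ℝ))) (abs_nonneg μ.im) zero_le_one
    ⟨pi_pos.le, le_rfl⟩ (fun s hs => by simpa using norm_ccos_mul_ofReal_le μ hs.1)
    (fun τ hτ => norm_ccos_mul_ofReal_le μ (sub_nonneg.2 hτ.2))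
  rwa [mul_one] at this

theorem norm_secondOrderTerm_le (h : IsRetardedKernel w σ S W) (a a' b c d d' μ : ℂ) :
    ‖secondOrderTerm w σ a a' b c d d' μ‖ ≤
      (‖c * a - d * b‖ + ‖d * a' + d' * a‖ + ‖d * a‖ * (W * π)) * exp (π * |μ.im|) := by
  have h1 := norm_ccos_mul_ofReal_le μ pi_pos.le
  have h2 := norm_csin_mul_ofReal_le μ pi_pos.le
  have h3 := h.norm_retardedCosIntegral_le μ
  rw [mul_comm π]
  refine (norm_add₃_le).trans ?_
  simp only [norm_mul (_ - _), norm_mul (_ + _), norm_mul (d * a)]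
  calc _ ≤ ‖c * a - d * b‖ * exp (|μ.im| * π) + ‖d * a' + d' * a‖ * exp (|μ.im| * π)
        + ‖d * a‖ * (W * π * exp (|μ.im| * π)) := by gcongr
    _ = _ := by ring

theorem norm_retardedCosIntegral_sub_le (h : IsRetardedKernel w σ S W) {z z' : ℂ}
    (hz : |z.im| ≤ 1) (hz' : |z'.im| ≤ 1) :
    ‖retardedCosIntegral w σ z - retardedCosIntegral w σ z'‖ ≤
      W * π * (2 * π * exp (2 * π)) * ‖z - z'‖ := by
  have h0 : (0 : ℝ) ∈ Icc 0 π := ⟨le_rfl, pi_pos.le⟩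
  have hπ : π ∈ Icc 0 π := ⟨pi_pos.le, le_rfl⟩
  have hW := h.bound_nonneg
  have hint : ∀ z : ℂ, IntervalIntegrable (fun τ : ℝ =>
      w τ * Complex.cos (z * σ τ) * Complex.cos (z * (π - τ : ℝ))) MeasureTheory.volume 0 π :=
    fun z => h.intervalIntegrable_mul (f := fun s => Complex.cos (z * s)) (by fun_prop)
      (by fun_prop) h0 hπ
  rw [retardedCosIntegral, retardedCosIntegral, ← intervalIntegral.integral_sub (hint z) (hint z')]
  refine (norm_integral_le_of_norm_le_off_finite (g := fun _ =>
    W * (2 * π * exp (2 * π) * ‖z - z'‖)) h.finite pi_pos.le (fun τ hτ => ?_)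
    intervalIntegrable_const).trans_eq ?_
  · rw [mul_assoc, mul_assoc, ← mul_sub, norm_mul]
    gcongr
    · exact h.norm_weight_le τ hτ
    · exact norm_ccos_mul_ccos_sub_le (h.arg_mem hτ)
        ⟨sub_nonneg.2 hτ.1.2, sub_le_self _ hτ.1.1⟩ hz hz'
  · rw [intervalIntegral.integral_const, sub_zero, smul_eq_mul]
    ring

theorem exists_norm_secondOrderTerm_sub_le (h : IsRetardedKernel w σ S W) (a a' b c d d' : ℂ) :
    ∃ L, 0 ≤ L ∧ ∀ z z' : ℂ, |z.im| ≤ 1 → |z'.im| ≤ 1 →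
      ‖secondOrderTerm w σ a a' b c d d' z - secondOrderTerm w σ a a' b c d d' z'‖
        ≤ L * ‖z - z'‖ := by
  have hW := h.bound_nonneg
  refine ⟨‖c * a - d * b‖ * (2 * π * exp (2 * π)) + ‖d * a' + d' * a‖ * (2 * π * exp (2 * π))
    + ‖d * a‖ * (W * π * (2 * π * exp (2 * π))), by positivity, fun z z' hz hz' => ?_⟩
  have h1 := norm_ccos_mul_ccos_sub_le (s := π) (t := 0) ⟨pi_pos.le, le_rfl⟩
    ⟨le_rfl, pi_pos.le⟩ hz hz'
  simp only [Complex.ofReal_zero, mul_zero, Complex.cos_zero, mul_one] at h1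
  have h2 := norm_csin_sub_csin_le hz hz'
  have h3 := h.norm_retardedCosIntegral_sub_le hz hz'
  have h4 : secondOrderTerm w σ a a' b c d d' z - secondOrderTerm w σ a a' b c d d' z' =
      (c * a - d * b) * (Complex.cos (z * π) - Complex.cos (z' * π))
      + (d * a' + d' * a) * (Complex.sin (z * π) - Complex.sin (z' * π))
      + d * a * (retardedCosIntegral w σ z - retardedCosIntegral w σ z') := by
    rw [secondOrderTerm, secondOrderTerm]
    ring
  rw [h4]
  refine (norm_add₃_le).trans ?_
  rw [norm_mul (c * a - d * b), norm_mul (d * a' + d' * a), norm_mul (d * a)]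
  calc _ ≤ ‖c * a - d * b‖ * (2 * π * exp (2 * π) * ‖z - z'‖)
        + ‖d * a' + d' * a‖ * (2 * π * exp (2 * π) * ‖z - z'‖)
        + ‖d * a‖ * (W * π * (2 * π * exp (2 * π)) * ‖z - z'‖) := by gcongr
    _ = _ := by ring

/-- First order approximation of the solution and its derivative. -/
theorem exists_first_order_bounds (h : IsRetardedKernel w σ S W) (a a' b b' : ℂ) :
    ∃ C R, 0 ≤ C ∧ ∀ (μ : ℂ) (y dy : ℝ → ℂ), IsRetardedSol w σ S μ y dy →
      y 0 = μ * a + a' → dy 0 = μ * b + b' → R ≤ ‖μ‖ →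
      ‖y π - μ * a * Complex.cos (μ * π)‖ ≤ C * exp (|μ.im| * π) ∧
      ‖dy π + μ ^ 2 * a * Complex.sin (μ * π) - μ * (b * Complex.cos (μ * π)
        - a' * Complex.sin (μ * π) - a * retardedCosIntegral w σ μ)‖
        ≤ C * exp (|μ.im| * π) := by
  have hW := h.bound_nonneg
  set D := ‖a‖ + ‖a'‖ + ‖b‖ + ‖b'‖ with hD
  set C₂ := D + W * π * (2 * D) with hC₂
  have hD0 : 0 ≤ D := by positivity
  have hC₂0 : 0 ≤ C₂ := by positivity
  refine ⟨C₂ + (D + W * π * C₂), max 1 (2 * (W * π)), by positivity,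
    fun μ y dy hy hy0 hdy0 hμ => ?_⟩
  have hm1 : 1 ≤ ‖μ‖ := (le_max_left _ _).trans hμ
  have hm0 : 0 < ‖μ‖ := by linarith
  have hmW : 2 * (W * π) ≤ ‖μ‖ := (le_max_right _ _).trans hμ
  have hπ : π ∈ Icc 0 π := ⟨pi_pos.le, le_rfl⟩
  have h0 : (0 : ℝ) ∈ Icc 0 π := ⟨le_rfl, pi_pos.le⟩
  have hy0n : ‖y 0‖ ≤ ‖μ‖ * (‖a‖ + ‖a'‖) := by
    rw [hy0]
    refine (norm_add_le _ _).trans ?_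
    rw [norm_mul]
    nlinarith [norm_nonneg a']
  have hdy0n : ‖dy 0‖ / ‖μ‖ ≤ ‖μ‖ * (‖b‖ + ‖b'‖) := by
    rw [hdy0, div_le_iff₀ hm0]
    refine (norm_add_le _ _).trans ?_
    rw [norm_mul]
    have : ‖μ‖ ≤ ‖μ‖ * ‖μ‖ := le_mul_of_one_le_left hm0.le hm1
    nlinarith [norm_nonneg b', norm_nonneg b, mul_nonneg (sub_nonneg.2 this) (norm_nonneg b),
      mul_nonneg (sub_nonneg.2 (hm1.trans this)) (norm_nonneg b')]
  have hyb : ∀ t ∈ Icc 0 π, ‖y t‖ ≤ (2 * D * ‖μ‖) * exp (|μ.im| * t) := by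
    intro t ht
    refine (h.norm_mul_sol_le hy hmW hm0 ht).trans ?_
    have : 2 * (‖y 0‖ + ‖dy 0‖ / ‖μ‖) ≤ 2 * D * ‖μ‖ := by
      rw [hD]
      linarith
    gcongr
  -- The integral equation determines `μ * r` with an error of the size of `y`, which is `O(|μ|)`
  -- times the exponential; dividing by `μ` gains one order.
  set r : ℝ → ℂ := fun t => y t - μ * a * Complex.cos (μ * t) with hr
  have hrb : ∀ t ∈ Icc 0 π, ‖r t‖ ≤ C₂ * exp (|μ.im| * t) := by
    intro t ht
    have h1 : μ * r t = μ * a' * Complex.cos (μ * t) + (μ * b + b') * Complex.sin (μ * t) -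
        ∫ τ in (0 : ℝ)..t, w τ * y (σ τ) * Complex.sin (μ * (t - τ : ℝ)) := by
      have h2 := hy.mul_eq h ht
      rw [hy0, hdy0] at h2
      rw [hr]
      linear_combination h2
    have h2 := h.norm_integral_mul_le_exp (f := y)
      (k := fun τ => Complex.sin (μ * (t - τ : ℝ))) (abs_nonneg μ.im)
      (by positivity : 0 ≤ 2 * D * ‖μ‖) ht hyb
      (fun τ hτ => norm_csin_mul_ofReal_le μ (sub_nonneg.2 hτ.2))
    have h3 := norm_csin_mul_ofReal_le μ ht.1
    have h4 := norm_ccos_mul_ofReal_le μ ht.1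
    set e := exp (|μ.im| * t) with he
    have he0 : 0 < e := exp_pos _
    have h5 : ‖μ * b + b'‖ ≤ ‖μ‖ * (‖b‖ + ‖b'‖) := by
      refine (norm_add_le _ _).trans ?_
      rw [norm_mul]
      nlinarith [norm_nonneg b']
    have h6 : ‖μ‖ * ‖r t‖ ≤ ‖μ‖ * (C₂ * e) := by
      rw [← norm_mul, h1]
      calc _ ≤ ‖μ‖ * ‖a'‖ * ‖Complex.cos (μ * t)‖ + ‖μ * b + b'‖ * ‖Complex.sin (μ * t)‖
            + W * π * (2 * D * ‖μ‖) * e := by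
            refine (norm_sub_le _ _).trans (add_le_add ((norm_add_le _ _).trans_eq ?_) h2)
            simp only [norm_mul]
        _ ≤ ‖μ‖ * ‖a'‖ * e + ‖μ‖ * (‖b‖ + ‖b'‖) * e + W * π * (2 * D * ‖μ‖) * e := by gcongr
        _ = ‖μ‖ * ((‖a'‖ + ‖b‖ + ‖b'‖ + W * π * (2 * D)) * e) := by ring
        _ ≤ _ := by
          gcongr
          rw [hC₂, hD]
          linarith [norm_nonneg a]
    exact le_of_mul_le_mul_left h6 hm0
  set e := exp (|μ.im| * π) with he
  have he0 : 0 < e := exp_pos _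
  constructor
  · refine (hrb π hπ).trans ?_
    gcongr
    have : 0 ≤ D + W * π * C₂ := by positivity
    linarith
  · have hrc : Continuous r := hy.continuous.sub (by fun_prop)
    have hk : Continuous fun τ : ℝ => Complex.cos (μ * (π - τ : ℝ)) := by fun_prop
    -- The leading part of `y` under the integral gives the cosine integral, while `r` contributes
    -- only to the error.
    have hsplit : (∫ τ in (0 : ℝ)..π, w τ * y (σ τ) * Complex.cos (μ * (π - τ : ℝ))) =
        μ * a * retardedCosIntegral w σ μ
          + ∫ τ in (0 : ℝ)..π, w τ * r (σ τ) * Complex.cos (μ * (π - τ : ℝ)) := by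
      rw [retardedCosIntegral, ← intervalIntegral.integral_const_mul,
        ← intervalIntegral.integral_add
          ((h.intervalIntegrable_mul (f := fun s => Complex.cos (μ * s)) (by fun_prop)
            hk h0 hπ).const_mul (μ * a)) (h.intervalIntegrable_mul hrc hk h0 hπ)]
      refine intervalIntegral.integral_congr fun τ _ => ?_
      simp only [hr]
      ring
    have h1 := hy.deriv_eq h hπ
    rw [hsplit, hy0, hdy0] at h1
    have h2 : dy π + μ ^ 2 * a * Complex.sin (μ * π) - μ * (b * Complex.cos (μ * π)
        - a' * Complex.sin (μ * π) - a * retardedCosIntegral w σ μ) =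
        b' * Complex.cos (μ * π) -
          ∫ τ in (0 : ℝ)..π, w τ * r (σ τ) * Complex.cos (μ * (π - τ : ℝ)) := by
      linear_combination h1
    rw [h2]
    have h3 := h.norm_integral_mul_le_exp (f := r)
      (k := fun τ => Complex.cos (μ * (π - τ : ℝ))) (abs_nonneg μ.im) hC₂0 hπ hrb
      (fun τ hτ => norm_ccos_mul_ofReal_le μ (sub_nonneg.2 hτ.2))
    have h4 := norm_ccos_mul_ofReal_le μ pi_pos.le
    calc _ ≤ ‖b'‖ * ‖Complex.cos (μ * π)‖ + W * π * C₂ * e := by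
          refine (norm_sub_le _ _).trans (add_le_add ?_ h3)
          rw [norm_mul]
      _ ≤ D * e + W * π * C₂ * e := by
          gcongr
          rw [hD]
          linarith [norm_nonneg a, norm_nonneg a', norm_nonneg b]
      _ ≤ _ := by
          have : 0 ≤ C₂ * e := by positivity
          linarith

/-- Expansion of the characteristic function. -/
theorem exists_expansion (h : IsRetardedKernel w σ S W) (a a' b b' c c' d d' : ℂ) :
    ∃ C R, 0 ≤ C ∧ ∀ (μ : ℂ) (y dy : ℝ → ℂ), IsRetardedSol w σ S μ y dy →
      y 0 = μ * a + a' → dy 0 = μ * b + b' → R ≤ ‖μ‖ →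
      ‖((μ * c + c') * y π - (μ * d + d') * dy π) - (a * d * μ ^ 3 * Complex.sin (μ * π)
        + μ ^ 2 * secondOrderTerm w σ a a' b c d d' μ)‖ ≤ C * ‖μ‖ * exp (π * |μ.im|) := by
  have hW := h.bound_nonneg
  obtain ⟨C, R, hC, hCR⟩ := h.exists_first_order_bounds a a' b b'
  refine ⟨‖c‖ * C + ‖c'‖ * (‖a‖ + C) + ‖d‖ * C + ‖d'‖ * (‖b‖ + ‖a'‖ + ‖a‖ * (W * π) + C),
    max 1 R, by positivity, fun μ y dy hy hy0 hdy0 hμ => ?_⟩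
  have hm1 : 1 ≤ ‖μ‖ := (le_max_left _ _).trans hμ
  obtain ⟨h1, h2⟩ := hCR μ y dy hy hy0 hdy0 ((le_max_right _ _).trans hμ)
  have h3 := norm_ccos_mul_ofReal_le μ pi_pos.le
  have h4 := norm_csin_mul_ofReal_le μ pi_pos.le
  have h5 := h.norm_retardedCosIntegral_le μ
  rw [mul_comm π |μ.im|]
  set e := exp (|μ.im| * π) with he
  have he0 : 0 < e := exp_pos _
  set κ := Complex.cos (μ * π) with hκ
  set s := Complex.sin (μ * π) with hs
  set I := retardedCosIntegral w σ μ with hI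
  set r := y π - μ * a * κ with hr
  set η := b * κ - a' * s - a * I with hη
  set ρ := dy π + μ ^ 2 * a * s - μ * η with hρ
  have hηb : ‖η‖ ≤ (‖b‖ + ‖a'‖ + ‖a‖ * (W * π)) * e := by
    calc ‖η‖ ≤ ‖b‖ * ‖κ‖ + ‖a'‖ * ‖s‖ + ‖a‖ * ‖I‖ := by
          rw [hη, ← norm_mul, ← norm_mul, ← norm_mul]
          exact (norm_sub_le _ _).trans (by gcongr; exact norm_sub_le _ _)
      _ ≤ ‖b‖ * e + ‖a'‖ * e + ‖a‖ * (W * π * e) := by gcongr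
      _ = _ := by ring
  have hmain : ((μ * c + c') * y π - (μ * d + d') * dy π) - (a * d * μ ^ 3 * s
        + μ ^ 2 * secondOrderTerm w σ a a' b c d d' μ) =
      μ * (c * r) + c' * (μ * a * κ + r) - (μ * (d * ρ) + d' * (μ * η + ρ)) := by
    rw [secondOrderTerm, ← hκ, ← hs, ← hI, hρ, hr, hη]
    ring
  have hmul : ∀ {x B : ℝ}, 0 ≤ B → x ≤ B → x ≤ ‖μ‖ * B := by
    intro x B hB hx
    nlinarith
  have hb1 : ‖μ * (c * r)‖ ≤ ‖μ‖ * (‖c‖ * (C * e)) := by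
    rw [norm_mul, norm_mul]
    gcongr
  have hb2 : ‖c' * (μ * a * κ + r)‖ ≤ ‖c'‖ * (‖μ‖ * (‖a‖ * e) + ‖μ‖ * (C * e)) := by
    rw [norm_mul]
    gcongr
    refine (norm_add_le _ _).trans (add_le_add ?_ (hmul (by positivity) h1))
    rw [norm_mul, norm_mul, mul_assoc]
    gcongr
  have hb3 : ‖μ * (d * ρ)‖ ≤ ‖μ‖ * (‖d‖ * (C * e)) := by
    rw [norm_mul, norm_mul]
    gcongr
  have hb4 : ‖d' * (μ * η + ρ)‖ ≤
      ‖d'‖ * (‖μ‖ * ((‖b‖ + ‖a'‖ + ‖a‖ * (W * π)) * e) + ‖μ‖ * (C * e)) := by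
    rw [norm_mul]
    gcongr
    refine (norm_add_le _ _).trans (add_le_add ?_ (hmul (by positivity) h2))
    rw [norm_mul]
    gcongr
  rw [hmain]
  calc _ ≤ ‖μ * (c * r)‖ + ‖c' * (μ * a * κ + r)‖ + (‖μ * (d * ρ)‖ + ‖d' * (μ * η + ρ)‖) :=
        (norm_sub_le _ _).trans (add_le_add (norm_add_le _ _) (norm_add_le _ _))
    _ ≤ _ := add_le_add (add_le_add hb1 hb2) (add_le_add hb3 hb4)
    _ = _ := by ring

end IsRetardedKernel

/-! ### Uniqueness for retarded equations -/

/-- A solution of a retarded equation with vanishing initial values vanishes. -/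
theorem eqOn_zero_of_retarded_equation {q : ℝ → ℂ} {σ : ℝ → ℝ} {S : Set ℝ} {W a b : ℝ} {μ : ℂ}
    {y dy : ℝ → ℂ} (hS : S.Finite) (hW : 0 ≤ W) (hq : ContinuousOn q (Icc a b \ S))
    (hσ : ContinuousOn σ (Icc a b \ S)) (hqW : ∀ t ∈ Icc a b \ S, ‖q t‖ ≤ W)
    (hσa : ∀ t ∈ Icc a b \ S, a ≤ σ t) (hσt : ∀ t ∈ Icc a b \ S, σ t ≤ t)
    (hy : ∀ t ∈ Icc a b, HasDerivWithinAt y (dy t) (Icc a b) t)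
    (hdy : ContinuousOn dy (Icc a b))
    (heq : ∀ t ∈ Icc a b \ S,
      HasDerivWithinAt dy (-(q t * y (σ t)) - μ ^ 2 * y t) (Icc a b) t)
    (hya : y a = 0) (hdya : dy a = 0) : ∀ t ∈ Icc a b, y t = 0 ∧ dy t = 0 := by
  intro t ht
  have hyc : ContinuousOn y (Icc a b) := fun t ht => (hy t ht).continuousWithinAt
  -- `K` bounds the growth rate of the first-order system for `(y, dy)`. With the weight `exp (-2 K
  -- t)`, integrating the system halves the weighted maximum `M`, so `M ≤ M / 2` and `M = 0`.
  set K : ℝ := 1 + W + ‖μ‖ ^ 2 with hK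
  have hK0 : 0 < K := by positivity
  obtain ⟨t₀, ht₀, hmax⟩ := isCompact_Icc.exists_isMaxOn (s := Icc a b)
    (f := fun t => (‖y t‖ + ‖dy t‖) * exp (-(2 * K * t))) ⟨t, ht⟩
    ((hyc.norm.add hdy.norm).mul (by fun_prop))
  set M := (‖y t₀‖ + ‖dy t₀‖) * exp (-(2 * K * t₀)) with hM
  have hM0 : 0 ≤ M := by positivity
  have hbound : ∀ s ∈ Icc a b, ‖y s‖ + ‖dy s‖ ≤ M * exp (2 * K * s) := by
    intro s hs
    have h1 : (‖y s‖ + ‖dy s‖) * exp (-(2 * K * s)) ≤ M := hmax hs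
    rwa [Real.exp_neg, ← div_eq_mul_inv, div_le_iff₀ (exp_pos _)] at h1
  have hsub : Icc a t₀ ⊆ Icc a b := Icc_subset_Icc_right ht₀.2
  have hσmem : ∀ τ ∈ Icc a b \ S, σ τ ∈ Icc a b :=
    fun τ hτ => ⟨hσa τ hτ, (hσt τ hτ).trans hτ.1.2⟩
  have hexp : ∫ τ in a..t₀, M * exp (2 * K * τ) ≤ M * exp (2 * K * t₀) / (2 * K) := by
    have h1 : ∀ τ : ℝ, HasDerivAt (fun τ => M * exp (2 * K * τ) / (2 * K))
        (M * exp (2 * K * τ)) τ := by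
      intro τ
      have h2 := ((((hasDerivAt_id τ).const_mul (2 * K)).exp.const_mul M).div_const (2 * K))
      refine h2.congr_deriv ?_
      simp only [id]
      field_simp
    rw [intervalIntegral.integral_eq_sub_of_hasDerivAt (fun τ _ => h1 τ)
      (Continuous.intervalIntegrable (by fun_prop) _ _)]
    have : 0 ≤ M * exp (2 * K * a) / (2 * K) := by positivity
    linarith
  have h1 : ‖y t₀‖ ≤ ∫ τ in a..t₀, M * exp (2 * K * τ) := by
    have hint := MeasureTheory.integral_eq_of_hasDerivAt_off_countable y dy (a := a) (b := t₀)
      countable_empty (by rw [uIcc_of_le ht₀.1]; exact hyc.mono hsub) (fun τ hτ => by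
        rw [min_eq_left ht₀.1, max_eq_right ht₀.1] at hτ
        exact (hy τ (hsub (Ioo_subset_Icc_self hτ.1))).hasDerivAt
          (Icc_mem_nhds hτ.1.1 (hτ.1.2.trans_le ht₀.2)))
      ((hdy.mono hsub).intervalIntegrable_of_Icc ht₀.1)
    rw [hya, sub_zero] at hint
    rw [← hint]
    refine norm_integral_le_of_norm_le_off_finite finite_empty ht₀.1 (fun τ hτ => ?_)
      (Continuous.intervalIntegrable (by fun_prop) _ _)
    exact (le_add_of_nonneg_left (norm_nonneg _)).trans (hbound τ (hsub hτ.1))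
  have h2 : ‖dy t₀‖ ≤ (W + ‖μ‖ ^ 2) * ∫ τ in a..t₀, M * exp (2 * K * τ) := by
    have hgb : ∀ τ ∈ Icc a b \ S, ‖-(q τ * y (σ τ)) - μ ^ 2 * y τ‖ ≤
        (W + ‖μ‖ ^ 2) * (M * exp (2 * K * τ)) := by
      intro τ hτ
      have h3 := (le_add_of_nonneg_right (norm_nonneg _)).trans (hbound τ hτ.1)
      have h4 := (le_add_of_nonneg_right (norm_nonneg _)).trans (hbound _ (hσmem τ hτ))
      have h5 : M * exp (2 * K * σ τ) ≤ M * exp (2 * K * τ) := by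
        gcongr
        exact hσt τ hτ
      refine (norm_sub_le _ _).trans ?_
      rw [norm_neg, norm_mul, norm_mul, norm_pow, add_mul]
      gcongr
      · exact hqW τ hτ
      · exact h4.trans h5
    have hgc : ContinuousOn (fun τ => -(q τ * y (σ τ)) - μ ^ 2 * y τ) (Icc a b \ S) := by
      have h3 : ContinuousOn (fun τ => y (σ τ)) (Icc a b \ S) := hyc.comp hσ hσmem
      have h4 : ContinuousOn y (Icc a b \ S) := hyc.mono sdiff_subset
      exact (hq.fun_mul h3).fun_neg.fun_sub (continuousOn_const.fun_mul h4)
    have hgi := intervalIntegrable_of_continuousOn_sdiff_finite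
      (C := (W + ‖μ‖ ^ 2) * (M * exp (2 * K * b))) hS hgc (fun τ hτ => (hgb τ hτ).trans (by
        gcongr
        exact hτ.1.2)) (c := a) (d := t₀) ⟨le_rfl, ht₀.1.trans ht₀.2⟩ ht₀
    have hint := MeasureTheory.integral_eq_of_hasDerivAt_off_countable dy _ (a := a) (b := t₀)
      hS.countable (by rw [uIcc_of_le ht₀.1]; exact hdy.mono hsub) (fun τ hτ => by
        rw [min_eq_left ht₀.1, max_eq_right ht₀.1] at hτ
        exact (heq τ ⟨hsub (Ioo_subset_Icc_self hτ.1), hτ.2⟩).hasDerivAt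
          (Icc_mem_nhds hτ.1.1 (hτ.1.2.trans_le ht₀.2))) hgi
    rw [hdya, sub_zero] at hint
    rw [← hint, ← intervalIntegral.integral_const_mul]
    exact norm_integral_le_of_norm_le_off_finite hS ht₀.1
      (fun τ hτ => hgb τ ⟨hsub hτ.1, hτ.2⟩) (Continuous.intervalIntegrable (by fun_prop) _ _)
  have h3 : ‖y t₀‖ + ‖dy t₀‖ ≤ M / 2 * exp (2 * K * t₀) := by
    calc _ ≤ K * ∫ τ in a..t₀, M * exp (2 * K * τ) := by
          rw [hK]
          linarith
      _ ≤ K * (M * exp (2 * K * t₀) / (2 * K)) := by gcongr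
      _ = _ := by field_simp
  have h4 : M ≤ M / 2 := by
    conv_lhs => rw [hM]
    rwa [Real.exp_neg, ← div_eq_mul_inv, div_le_iff₀ (exp_pos _)]
  have h5 : M = 0 := by linarith
  have h6 := hbound t ht
  rw [h5, zero_mul] at h6
  exact ⟨norm_le_zero_iff.1 (by linarith [norm_nonneg (dy t)]),
    norm_le_zero_iff.1 (by linarith [norm_nonneg (y t)])⟩

/-! ### The problem with transmission conditions -/

namespace RetardedSL

variable {m : ℕ} (P : RetardedSL m)

/-- The set of transmission points. -/
def transmissionSet : Set ℝ := range fun j : Fin m => P.θ j.castSucc.succ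

theorem finite_transmissionSet : P.transmissionSet.Finite := finite_range _

theorem closedPiece_subset (i : Fin (m + 1)) : P.closedPiece i ⊆ Icc 0 π := by
  rw [← P.θ_zero, ← P.θ_last]
  exact Icc_subset_Icc (P.θ_strictMono.monotone (Fin.zero_le _))
    (P.θ_strictMono.monotone (Fin.le_last _))

theorem exists_mem_closedPiece {t : ℝ} (ht : t ∈ Icc 0 π) : ∃ i, t ∈ P.closedPiece i := by
  have key : ∀ k : Fin (m + 2), t ≤ P.θ k → ∃ i, t ∈ P.closedPiece i := by
    intro k
    induction k using Fin.induction with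
    | zero =>
      intro h
      refine ⟨0, ?_, ?_⟩
      · rw [Fin.castSucc_zero, P.θ_zero]
        exact ht.1
      · exact h.trans (P.θ_strictMono.monotone (Fin.zero_le _))
    | succ i ih =>
      intro h
      rcases le_or_gt t (P.θ i.castSucc) with h1 | h1
      · exact ih h1
      · exact ⟨i, h1.le, h⟩
  exact key (Fin.last _) (by rw [P.θ_last]; exact ht.2)

/-- Local boundedness and compactness: near a transmission point the two one-sided limits give the
bound, elsewhere continuity does. -/
theorem exists_abs_q_le : ∃ W, 0 ≤ W ∧ ∀ t ∈ Icc 0 π \ P.transmissionSet, |P.q t| ≤ W := by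
  have key : ∃ C, ∀ t ∈ Icc 0 π ∩ (Icc 0 π \ P.transmissionSet), |P.q t| ≤ C := by
    refine isCompact_Icc.induction_on
      (p := fun s => ∃ C, ∀ t ∈ s ∩ (Icc 0 π \ P.transmissionSet), |P.q t| ≤ C) ⟨0, by simp⟩
      ?_ ?_ ?_
    · rintro s s' hss ⟨C, hC⟩
      exact ⟨C, fun t ht => hC t ⟨hss ht.1, ht.2⟩⟩
    · rintro s s' ⟨C, hC⟩ ⟨C', hC'⟩
      refine ⟨max C C', fun t ht => ?_⟩
      rcases ht.1 with h | h
      · exact (hC t ⟨h, ht.2⟩).trans (le_max_left _ _)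
      · exact (hC' t ⟨h, ht.2⟩).trans (le_max_right _ _)
    · intro x hx
      have hloc : ∃ C, ∀ᶠ t in 𝓝 x, t ∈ Icc 0 π \ P.transmissionSet → |P.q t| ≤ C := by
        by_cases hxS : x ∈ P.transmissionSet
        · obtain ⟨j, rfl⟩ := hxS
          obtain ⟨l, hl⟩ := P.q_left_limit j
          obtain ⟨l', hl'⟩ := P.q_right_limit j
          refine ⟨max (|l| + 1) (|l'| + 1), ?_⟩
          have h1 := hl.abs.eventually_le_const (lt_add_one |l|)
          have h2 := hl'.abs.eventually_le_const (lt_add_one |l'|)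
          have h3 : ∀ᶠ t in 𝓝[≠] (P.θ j.castSucc.succ),
              |P.q t| ≤ max (|l| + 1) (|l'| + 1) := by
            rw [← nhdsLT_sup_nhdsGT, eventually_sup]
            exact ⟨h1.mono fun t h => h.trans (le_max_left _ _),
              h2.mono fun t h => h.trans (le_max_right _ _)⟩
          refine (eventually_nhdsWithin_iff.1 h3).mono fun t h ht => h ?_
          rintro rfl
          exact ht.2 ⟨j, rfl⟩
        · exact ⟨|P.q x| + 1, eventually_nhdsWithin_iff.1
            ((P.q_continuousOn x ⟨hx, hxS⟩).abs.eventually_le_const (lt_add_one _))⟩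
      obtain ⟨C, hC⟩ := hloc
      exact ⟨_, mem_nhdsWithin_of_mem_nhds hC, C, fun t ht => ht.1 ht.2⟩
  obtain ⟨C, hC⟩ := key
  exact ⟨max C 0, le_max_right _ _, fun t ht => (hC t ⟨ht.1, ht⟩).trans (le_max_left _ _)⟩

theorem exists_isRetardedKernel : ∃ W, IsRetardedKernel (fun t => (P.q t : ℂ))
    (fun t => t - P.Δ t) P.transmissionSet W := by
  obtain ⟨W, hW, hqW⟩ := P.exists_abs_q_le
  refine ⟨W, P.finite_transmissionSet, ?_, ?_, hW, ?_, ?_, ?_⟩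
  · exact Complex.continuous_ofReal.comp_continuousOn P.q_continuousOn
  · exact continuousOn_id.sub P.Δ_continuousOn
  · intro t ht
    rw [Complex.norm_real]
    exact hqW t ht
  · intro t ht
    obtain ⟨i, hi⟩ := P.exists_mem_closedPiece ht.1
    refine le_trans ?_ (P.le_sub_Δ i t ⟨hi, ht.2⟩)
    rw [← P.θ_zero]
    exact P.θ_strictMono.monotone (Fin.zero_le _)
  · intro t ht
    linarith [P.Δ_nonneg t ht]

/-- The product of the transmission coefficients up to the `i`-th interval. -/
noncomputable def partialDelta : Fin (m + 1) → ℂ := Fin.partialProd fun j => (P.δ j : ℂ)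

theorem partialDelta_zero : P.partialDelta 0 = 1 := Fin.partialProd_zero _

theorem partialDelta_succ (j : Fin m) :
    P.partialDelta j.succ = P.partialDelta j.castSucc * P.δ j := Fin.partialProd_succ _ _

theorem partialDelta_ne_zero (i : Fin (m + 1)) : P.partialDelta i ≠ 0 := by
  induction i using Fin.induction with
  | zero => simp [partialDelta_zero]
  | succ j ih =>
    rw [partialDelta_succ]
    exact mul_ne_zero ih (by exact_mod_cast P.δ_ne_zero j)

theorem partialDelta_last : P.partialDelta (Fin.last m) = ∏ j, (P.δ j : ℂ) := by
  rw [partialDelta, Fin.partialProd, List.take_of_length_le (by simp), List.prod_ofFn]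

/-- Dividing a solution that is `C¹` on all of `[0, π]` by the partial products creates exactly the
prescribed jumps of value and derivative. -/
theorem isSolution_of_isRetardedSol {μ : ℂ} {y dy : ℝ → ℂ}
    (hy : IsRetardedSol (fun t => (P.q t : ℂ)) (fun t => t - P.Δ t) P.transmissionSet μ y dy) :
    P.IsSolution μ (fun i t => y t / P.partialDelta i) (fun i t => dy t / P.partialDelta i) where
  hasDeriv i t ht :=
    ((hy.hasDeriv t (P.closedPiece_subset i ht)).mono (P.closedPiece_subset i)).div_const _
  continuousOn_deriv i := (hy.continuous_deriv.div_const _).continuousOn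
  equation i t ht := by
    have h1 := ((hy.equation t ⟨P.closedPiece_subset i ht.1, ht.2⟩).mono
      (P.closedPiece_subset i)).div_const (P.partialDelta i)
    refine h1.congr_deriv ?_
    ring
  transmission j := by
    have h1 := P.partialDelta_ne_zero j.castSucc
    have h2 : (P.δ j : ℂ) ≠ 0 := by exact_mod_cast P.δ_ne_zero j
    rw [partialDelta_succ]
    field_simp
    ring
  transmission_deriv j := by
    have h1 := P.partialDelta_ne_zero j.castSucc
    have h2 : (P.δ j : ℂ) ≠ 0 := by exact_mod_cast P.δ_ne_zero j
    rw [partialDelta_succ]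
    field_simp
    ring

variable {P}

theorem IsSolution.linearCombination {μ : ℂ} {y dy z dz : Fin (m + 1) → ℝ → ℂ}
    (hy : P.IsSolution μ y dy) (hz : P.IsSolution μ z dz) (c d : ℂ) :
    P.IsSolution μ (fun i t => c * y i t + d * z i t) (fun i t => c * dy i t + d * dz i t) where
  hasDeriv i t ht := ((hy.hasDeriv i t ht).const_mul c).fun_add ((hz.hasDeriv i t ht).const_mul d)
  continuousOn_deriv i :=
    ((hy.continuousOn_deriv i).const_mul c).fun_add ((hz.continuousOn_deriv i).const_mul d)
  equation i t ht := by
    refine (((hy.equation i t ht).const_mul c).fun_add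
      ((hz.equation i t ht).const_mul d)).congr_deriv ?_
    ring
  transmission j := by
    linear_combination c * hy.transmission j + d * hz.transmission j
  transmission_deriv j := by
    linear_combination c * hy.transmission_deriv j + d * hz.transmission_deriv j

/-- Vanishing propagates from one interval to the next: the retarded argument never looks back
across a transmission point, and `δ j ≠ 0` carries zero data over it. -/
theorem IsSolution.eq_zero {μ : ℂ} {y dy : Fin (m + 1) → ℝ → ℂ} (hy : P.IsSolution μ y dy)
    (h0 : y 0 0 = 0) (h0' : dy 0 0 = 0) (i : Fin (m + 1)) :
    ∀ t ∈ P.closedPiece i, y i t = 0 ∧ dy i t = 0 := by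
  obtain ⟨W, hW⟩ := P.exists_isRetardedKernel
  have hsub : ∀ i, P.closedPiece i \ P.transmissionSet ⊆ Icc 0 π \ P.transmissionSet :=
    fun i => sdiff_subset_sdiff_left (P.closedPiece_subset i)
  have key : ∀ i : Fin (m + 1), y i (P.θ i.castSucc) = 0 → dy i (P.θ i.castSucc) = 0 →
      ∀ t ∈ P.closedPiece i, y i t = 0 ∧ dy i t = 0 := fun i h1 h2 =>
    eqOn_zero_of_retarded_equation (μ := μ) P.finite_transmissionSet hW.bound_nonneg
      (hW.continuousOn_weight.mono (hsub i)) (hW.continuousOn_arg.mono (hsub i))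
      (fun t ht => hW.norm_weight_le t (hsub i ht)) (P.le_sub_Δ i)
      (fun t ht => hW.arg_le t (hsub i ht)) (hy.hasDeriv i) (hy.continuousOn_deriv i)
      (hy.equation i) h1 h2
  induction i using Fin.induction with
  | zero =>
    refine key 0 ?_ ?_
    · rwa [Fin.castSucc_zero, P.θ_zero]
    · rwa [Fin.castSucc_zero, P.θ_zero]
  | succ j ih =>
    have hδ : (P.δ j : ℂ) ≠ 0 := by exact_mod_cast P.δ_ne_zero j
    have hmem : P.θ j.castSucc.succ ∈ P.closedPiece j.castSucc :=
      ⟨P.θ_strictMono.monotone (Fin.castSucc_lt_succ).le, le_rfl⟩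
    obtain ⟨h1, h2⟩ := ih _ hmem
    have h3 := hy.transmission j
    have h4 := hy.transmission_deriv j
    rw [h1, zero_sub, neg_eq_zero, mul_eq_zero, or_iff_right hδ] at h3
    rw [h2, zero_sub, neg_eq_zero, mul_eq_zero, or_iff_right hδ] at h4
    exact key j.succ (by rwa [← Fin.succ_castSucc]) (by rwa [← Fin.succ_castSucc])

theorem IsSolution.eqOn {μ : ℂ} {y dy z dz : Fin (m + 1) → ℝ → ℂ}
    (hy : P.IsSolution μ y dy) (hz : P.IsSolution μ z dz) (h0 : y 0 0 = z 0 0)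
    (h0' : dy 0 0 = dz 0 0) (i : Fin (m + 1)) :
    EqOn (y i) (z i) (P.closedPiece i) ∧ EqOn (dy i) (dz i) (P.closedPiece i) := by
  have h := (hy.linearCombination hz 1 (-1)).eq_zero (by simp [h0]) (by simp [h0']) i
  constructor
  · intro t ht
    have := (h t ht).1
    linear_combination this
  · intro t ht
    have := (h t ht).2
    linear_combination this

theorem zero_mem_closedPiece : (0 : ℝ) ∈ P.closedPiece 0 := by
  refine ⟨?_, ?_⟩
  · rw [Fin.castSucc_zero, P.θ_zero]
  · rw [← P.θ_zero]
    exact P.θ_strictMono.monotone (Fin.zero_le _)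

theorem pi_mem_closedPiece : π ∈ P.closedPiece (Fin.last m) := by
  refine ⟨?_, ?_⟩
  · rw [← P.θ_last]
    exact P.θ_strictMono.monotone (Fin.le_last _)
  · rw [Fin.succ_last, P.θ_last]

/-- If `y` vanished everywhere, its one-sided derivative at 0 would vanish too, because the first
interval is nondegenerate. -/
theorem IsSolution.exists_ne_zero {μ : ℂ} {y dy : Fin (m + 1) → ℝ → ℂ}
    (hy : P.IsSolution μ y dy) (h : y 0 0 ≠ 0 ∨ dy 0 0 ≠ 0) :
    ∃ i, ∃ t ∈ P.closedPiece i, y i t ≠ 0 := by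
  by_contra! hzero
  have h0 := zero_mem_closedPiece (P := P)
  rcases h with h | h
  · exact h (hzero 0 0 h0)
  · have h1 : HasDerivWithinAt (y 0) 0 (P.closedPiece 0) 0 :=
      (hasDerivWithinAt_const (0 : ℝ) (P.closedPiece 0) (0 : ℂ)).congr
        (fun t ht => hzero 0 t ht) (hzero 0 0 h0)
    have hlt : P.θ (0 : Fin (m + 1)).castSucc < P.θ (0 : Fin (m + 1)).succ :=
      P.θ_strictMono Fin.castSucc_lt_succ
    exact h ((uniqueDiffOn_Icc hlt 0 h0).eq_deriv _ (hy.hasDeriv 0 0 h0) h1)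

variable (P)

theorem exists_isSolution (μ a b : ℂ) :
    ∃ y dy, P.IsSolution μ y dy ∧ y 0 0 = a ∧ dy 0 0 = b := by
  obtain ⟨W, hW⟩ := P.exists_isRetardedKernel
  obtain ⟨y, dy, h, -, -⟩ := hW.exists_isRetardedSol (a := fun _ => a) (b := fun _ => b)
    (by fun_prop) (by fun_prop)
  obtain ⟨h1, h2, h3⟩ := h μ
  exact ⟨_, _, P.isSolution_of_isRetardedSol h1, by simp [partialDelta_zero, h2],
    by simp [partialDelta_zero, h3]⟩

/-- The left-hand side of the boundary condition at `π`. -/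
noncomputable def rightBoundary (μ : ℂ) (y dy : Fin (m + 1) → ℝ → ℂ) : ℂ :=
  (μ * P.β₁p + P.β₁m) * y (Fin.last m) π - (μ * P.β₂p + P.β₂m) * dy (Fin.last m) π

theorem Xi_eq_rightBoundary {μ : ℂ} {φ dφ : Fin (m + 1) → ℝ → ℂ} (h : P.IsPhi μ φ dφ) :
    P.Xi μ = P.rightBoundary μ φ dφ := by
  have hex : ∃ Y : (Fin (m + 1) → ℝ → ℂ) × (Fin (m + 1) → ℝ → ℂ), P.IsPhi μ Y.1 Y.2 :=
    ⟨(φ, dφ), h⟩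
  have hs := hex.choose_spec
  have heq := hs.isSolution.eqOn h.isSolution (by rw [hs.initial, h.initial])
    (by rw [hs.initial_deriv, h.initial_deriv]) (Fin.last m)
  have hπ := pi_mem_closedPiece (P := P)
  rw [Xi, dif_pos hex, heq.1 hπ, heq.2 hπ, rightBoundary]

theorem exists_isPhi (μ : ℂ) : ∃ φ dφ, P.IsPhi μ φ dφ := by
  obtain ⟨y, dy, h, h0, h1⟩ := P.exists_isSolution μ (μ * P.α₂p + P.α₂m) (μ * P.α₁p + P.α₁m)
  exact ⟨y, dy, h, h0, h1⟩

/-- With `A = φ 0` and `B = φ' 0` the left boundary condition reads `B * y 0 = A * y' 0`. Unless `A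
= B = 0`, it forces `y` to be a multiple of `φ`, and the right condition becomes `Xi μ = 0`. If `A =
B = 0`, then `φ` vanishes and the left condition is void. -/
theorem isSpectral_iff (μ : ℂ) : P.IsSpectral μ ↔ P.Xi μ = 0 := by
  obtain ⟨φ, dφ, hφ⟩ := P.exists_isPhi μ
  rw [P.Xi_eq_rightBoundary hφ]
  have hφs := hφ.isSolution
  have hπ := pi_mem_closedPiece (P := P)
  set A : ℂ := μ * P.α₂p + P.α₂m with hA
  set B : ℂ := μ * P.α₁p + P.α₁m with hB
  have hφ0 : φ 0 0 = A := hφ.initial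
  have hdφ0 : dφ 0 0 = B := hφ.initial_deriv
  constructor
  · rintro ⟨y, dy, hy, hl, hr, i, t, ht, hyt⟩
    by_cases hAB : A = 0 ∧ B = 0
    · obtain ⟨h1, h2⟩ := hφs.eq_zero (hφ0.trans hAB.1) (hdφ0.trans hAB.2) _ π hπ
      simp [rightBoundary, h1, h2]
    · have hk : ∃ k : ℂ, y 0 0 = k * A ∧ dy 0 0 = k * B := by
        have hl' : B * y 0 0 = A * dy 0 0 := by
          rw [hA, hB]
          linear_combination hl
        by_cases hA0 : A = 0
        · have hB0 : B ≠ 0 := fun h => hAB ⟨hA0, h⟩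
          refine ⟨dy 0 0 / B, ?_, by field_simp⟩
          rw [hA0, zero_mul] at hl'
          rw [hA0, mul_zero]
          exact (mul_eq_zero.1 hl').resolve_left hB0
        · refine ⟨y 0 0 / A, by field_simp, ?_⟩
          field_simp
          linear_combination -hl'
      obtain ⟨k, hk1, hk2⟩ := hk
      have heq := hy.eqOn (hφs.linearCombination hφs k 0) (by simp [hk1, hφ0])
        (by simp [hk2, hdφ0])
      have hk0 : k ≠ 0 := by
        rintro rfl
        refine hyt ?_
        rw [(heq i).1 ht]
        simp
      have h1 := (heq (Fin.last m)).1 hπ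
      have h2 := (heq (Fin.last m)).2 hπ
      simp only [zero_mul, add_zero] at h1 h2
      rw [h1, h2] at hr
      refine (mul_eq_zero.1 ?_).resolve_left hk0
      rw [rightBoundary]
      linear_combination hr
  · intro hXi
    have hex : ∃ y dy, P.IsSolution μ y dy ∧ (y 0 0 ≠ 0 ∨ dy 0 0 ≠ 0) ∧
        B * y 0 0 = A * dy 0 0 ∧ P.rightBoundary μ y dy = 0 := by
      -- In the degenerate case only the right condition remains: one linear equation on the
      -- two-dimensional space of solutions, which has a nonzero solution.
      by_cases hAB : A = 0 ∧ B = 0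
      · obtain ⟨u, du, hu, hu0, hdu0⟩ := P.exists_isSolution μ 1 0
        obtain ⟨v, dv, hv, hv0, hdv0⟩ := P.exists_isSolution μ 0 1
        by_cases hRu : P.rightBoundary μ u du = 0
        · exact ⟨u, du, hu, by simp [hu0], by simp [hAB.1, hAB.2], hRu⟩
        · refine ⟨_, _, hu.linearCombination hv (-P.rightBoundary μ v dv)
            (P.rightBoundary μ u du), Or.inr ?_, by simp [hAB.1, hAB.2], ?_⟩
          · simpa [hdu0, hdv0] using hRu
          · simp only [rightBoundary]
            ring
      · refine ⟨φ, dφ, hφs, ?_, by rw [hφ0, hdφ0, mul_comm], hXi⟩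
        rw [hφ0, hdφ0]
        tauto
    obtain ⟨y, dy, hy, hne, hl, hr⟩ := hex
    refine ⟨y, dy, hy, ?_, ?_, hy.exists_ne_zero hne⟩
    · rw [hA, hB] at hl
      linear_combination hl
    · rw [rightBoundary] at hr
      linear_combination hr

end RetardedSL

/-! ### The characteristic function and its zeros -/

namespace RetardedSL

variable {m : ℕ} (P : RetardedSL m)

theorem exists_Xi_eq : ∃ y dy : ℂ → ℝ → ℂ,
    (∀ μ, IsRetardedSol (fun t => (P.q t : ℂ)) (fun t => t - P.Δ t) P.transmissionSet μ
      (y μ) (dy μ) ∧ y μ 0 = μ * P.α₂p + P.α₂m ∧ dy μ 0 = μ * P.α₁p + P.α₁m) ∧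
    (∀ t, Differentiable ℂ fun μ => y μ t) ∧ (∀ t, Differentiable ℂ fun μ => dy μ t) ∧
    ∀ μ, P.Xi μ = ((μ * P.β₁p + P.β₁m) * y μ π - (μ * P.β₂p + P.β₂m) * dy μ π)
      / ∏ j, (P.δ j : ℂ) := by
  obtain ⟨W, hW⟩ := P.exists_isRetardedKernel
  obtain ⟨y, dy, h, hd, hd'⟩ := hW.exists_isRetardedSol
    (a := fun μ => μ * P.α₂p + P.α₂m) (b := fun μ => μ * P.α₁p + P.α₁m)
    (by fun_prop) (by fun_prop)
  refine ⟨y, dy, h, hd, hd', fun μ => ?_⟩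
  obtain ⟨h1, h2, h3⟩ := h μ
  rw [P.Xi_eq_rightBoundary ⟨P.isSolution_of_isRetardedSol h1, by simp [partialDelta_zero, h2],
    by simp [partialDelta_zero, h3]⟩, rightBoundary, partialDelta_last]
  ring

theorem differentiable_Xi : Differentiable ℂ P.Xi := by
  obtain ⟨y, dy, -, hd, hd', hXi⟩ := P.exists_Xi_eq
  have h1 := hd π
  have h2 := hd' π
  rw [funext hXi]
  fun_prop

theorem analyticOrderAt_Xi₀ (z : ℂ) :
    analyticOrderAt P.Xi₀ z = {k | (muZero k : ℂ) = z}.encard := by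
  have ha : (P.α₂p * P.β₂p : ℂ) / ∏ j, (P.δ j : ℂ) ≠ 0 := by
    refine div_ne_zero (by exact_mod_cast P.α₂p_mul_β₂p_ne_zero) ?_
    exact Finset.prod_ne_zero_iff.2 fun j _ => by exact_mod_cast P.δ_ne_zero j
  rw [← analyticOrderAt_cube_mul_csin ha z]
  congr 1
  ext w
  rw [Xi₀]
  ring

/-- At an integer `n`, `cos (n (π - τ)) = (-1) ^ n cos (n τ)`. Then `2 cos (n (τ - Δ)) cos (n τ)` is
the sum of the cosines of the difference `n Δ` and of the sum `n (2 τ - Δ)`. -/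
theorem retardedCosIntegral_int (n : ℤ) :
    (-1) ^ n * retardedCosIntegral (fun t => (P.q t : ℂ)) (fun t => t - P.Δ t) n
      = ((P.Uplus n + P.Vplus n : ℝ) : ℂ) := by
  obtain ⟨W, hW, hqW⟩ := P.exists_abs_q_le
  have hint : ∀ f : ℝ → ℝ, ContinuousOn f (Icc 0 π \ P.transmissionSet) →
      IntervalIntegrable (fun τ => P.q τ * cos (n * f τ)) MeasureTheory.volume 0 π := by
    intro f hf
    refine intervalIntegrable_of_continuousOn_sdiff_finite (C := W) P.finite_transmissionSet
      (P.q_continuousOn.fun_mul (continuous_cos.comp_continuousOn (continuousOn_const.fun_mul hf)))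
      (fun t ht => ?_) ⟨le_rfl, pi_pos.le⟩ ⟨pi_pos.le, le_rfl⟩
    rw [norm_mul, Real.norm_eq_abs, Real.norm_eq_abs]
    calc _ ≤ W * 1 := by
          gcongr
          · exact hqW t ht
          · exact abs_cos_le_one _
      _ = W := mul_one W
  have h1 := hint P.Δ P.Δ_continuousOn
  have h2 := hint (fun τ => 2 * τ - P.Δ τ)
    ((continuousOn_const.fun_mul continuousOn_id).fun_sub P.Δ_continuousOn)
  have hσ : ((-1 : ℝ) ^ n) * (-1) ^ n = 1 := by
    rw [← mul_zpow]
    simp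
  rw [Uplus, Vplus, ← mul_add, ← intervalIntegral.integral_add h1 h2,
    ← intervalIntegral.integral_const_mul, retardedCosIntegral,
    ← intervalIntegral.integral_const_mul,
    ← intervalIntegral.integral_ofReal]
  refine intervalIntegral.integral_congr fun τ _ => ?_
  have h3 : cos (n * (π - τ)) = (-1) ^ n * cos (n * τ) := by
    rw [mul_sub, Real.cos_int_mul_pi_sub]
  have h4 : P.q τ * cos (n * P.Δ τ) + P.q τ * cos (n * (2 * τ - P.Δ τ)) =
      2 * (P.q τ * (cos (n * (τ - P.Δ τ)) * cos (n * τ))) := by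
    rw [show (n : ℝ) * P.Δ τ = n * τ - n * (τ - P.Δ τ) by ring,
      show (n : ℝ) * (2 * τ - P.Δ τ) = n * τ + n * (τ - P.Δ τ) by ring, Real.cos_sub, Real.cos_add]
    ring
  have h5 : (-1) ^ n * (P.q τ * cos (n * (τ - P.Δ τ)) * cos (n * (π - τ))) =
      1 / 2 * (P.q τ * cos (n * P.Δ τ) + P.q τ * cos (n * (2 * τ - P.Δ τ))) := by
    rw [h3, h4]
    linear_combination (P.q τ * cos (n * (τ - P.Δ τ)) * cos (n * τ)) * hσ
  rw [← h5]
  push_cast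
  ring

theorem exists_enumeration_Xi : ∃ μ : ℤˣ × ℕ → ℂ,
    (∀ z : ℂ, analyticOrderAt P.Xi z = {k | μ k = z}.encard) ∧
    (fun k => μ k - ((muZero k - 1 / (muZero k * π) *
      (P.β₁p / P.β₂p - P.α₁p / P.α₂p + P.Uplus (muZero k) + P.Vplus (muZero k)) : ℝ) : ℂ))
      =O[cofinite] fun k => 1 / (muZero k) ^ 2 := by
  obtain ⟨W, hW⟩ := P.exists_isRetardedKernel
  obtain ⟨y, dy, hy, -, -, hXi⟩ := P.exists_Xi_eq
  set p : ℂ := ∏ j, (P.δ j : ℂ) with hp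
  have hp0 : p ≠ 0 := Finset.prod_ne_zero_iff.2 fun j _ => by exact_mod_cast P.δ_ne_zero j
  have hα : (P.α₂p : ℂ) ≠ 0 := by exact_mod_cast left_ne_zero_of_mul P.α₂p_mul_β₂p_ne_zero
  have hβ : (P.β₂p : ℂ) ≠ 0 := by exact_mod_cast right_ne_zero_of_mul P.α₂p_mul_β₂p_ne_zero
  obtain ⟨C, R, hC, hCR⟩ := hW.exists_expansion P.α₂p P.α₂m P.α₁p P.α₁m P.β₁p P.β₁m P.β₂p P.β₂m
  obtain ⟨L, hL, hHL⟩ := hW.exists_norm_secondOrderTerm_sub_le P.α₂p P.α₂m P.α₁p P.β₁p P.β₂p P.β₂m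
  have hHb := hW.norm_secondOrderTerm_le P.α₂p P.α₂m P.α₁p P.β₁p P.β₂p P.β₂m
  set H : ℂ → ℂ := secondOrderTerm (fun t => (P.q t : ℂ)) (fun t => t - P.Δ t)
    P.α₂p P.α₂m P.α₁p P.β₁p P.β₂p P.β₂m with hH
  set C' : ℝ := ‖(P.β₁p : ℂ) * P.α₂p - P.β₂p * P.α₁p‖ + ‖(P.β₂p : ℂ) * P.α₂m + P.β₂m * P.α₂p‖
    + ‖(P.β₂p : ℂ) * P.α₂p‖ * (W * π) with hC'
  have hW0 := hW.bound_nonneg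
  have hC'0 : 0 ≤ C' := by positivity
  -- `E` is defined as the remainder, so the decomposition is an identity and the content lies in
  -- its bound. The factor `1 / p` undoes the removal of the jumps and cancels in `H / a`.
  refine exists_enumeration_and_asymptotics P.differentiable_Xi
    (a := (P.α₂p * P.β₂p : ℂ) / p) (H := fun z => H z / p)
    (E := fun z => P.Xi z - ((P.α₂p * P.β₂p : ℂ) / p * z ^ 3 * Complex.sin (z * π)
      + z ^ 2 * (H z / p))) (R := R) (C := (C' + C) / ‖p‖) (L := L / ‖p‖)
    (div_ne_zero (mul_ne_zero hα hβ) hp0) (by positivity) (by positivity) (fun z => by ring)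
    (fun z => ?_) (fun z hz => ?_)
    (fun z n hz => ?_) (G := fun x => P.β₁p / P.β₂p - P.α₁p / P.α₂p + P.Uplus x + P.Vplus x)
    (fun n => ?_)
  · rw [norm_div, div_mul_eq_mul_div]
    gcongr
    refine (hHb z).trans ?_
    gcongr
    linarith
  · obtain ⟨h1, h2, h3⟩ := hy z
    have h4 := hCR z (y z) (dy z) h1 h2 h3 hz
    have h5 : P.Xi z - ((P.α₂p * P.β₂p : ℂ) / p * z ^ 3 * Complex.sin (z * π)
        + z ^ 2 * (H z / p)) = (((z * P.β₁p + P.β₁m) * y z π - (z * P.β₂p + P.β₂m) * dy z π) -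
        (P.α₂p * P.β₂p * z ^ 3 * Complex.sin (z * π) + z ^ 2 * H z)) / p := by
      rw [hXi]
      ring
    rw [h5, norm_div, div_mul_eq_mul_div, div_mul_eq_mul_div]
    gcongr
    refine h4.trans ?_
    gcongr
    linarith
  · rw [← sub_div, norm_div, div_mul_eq_mul_div]
    gcongr
    exact hHL z n hz (by simp)
  · have h1 := P.retardedCosIntegral_int n
    have hσ : ((-1 : ℂ) ^ n) * (-1) ^ n = 1 := by
      rw [← mul_zpow]
      simp
    have h2 : Complex.cos (n * π) = (-1) ^ n := by
      have := congrArg Complex.ofReal (Real.cos_int_mul_pi n)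
      push_cast at this
      exact this
    have h3 : (-1) ^ n * H n = (P.β₁p * P.α₂p - P.β₂p * P.α₁p)
        + P.β₂p * P.α₂p * ((P.Uplus n + P.Vplus n : ℝ) : ℂ) := by
      rw [hH, secondOrderTerm, h2, Complex.sin_int_mul_pi, ← h1]
      linear_combination (P.β₁p * P.α₂p - P.β₂p * P.α₁p : ℂ) * hσ
    rw [show (-1) ^ n * (H n / p) / ((P.α₂p * P.β₂p : ℂ) / p)
      = ((-1) ^ n * H n) / (P.α₂p * P.β₂p) by field_simp, h3]
    push_cast
    field_simp
    ring

end RetardedSL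

theorem theorem2p1 {m : ℕ} (P : RetardedSL m) :
    -- the solution `φ (·, μ)` exists and is unique, and `Ξ` is entire
    (∀ μ : ℂ, ∃ φ dφ, P.IsPhi μ φ dφ) ∧
    (∀ (μ : ℂ) (φ dφ ψ dψ : Fin (m + 1) → ℝ → ℂ), P.IsPhi μ φ dφ → P.IsPhi μ ψ dψ →
      ∀ i, EqOn (φ i) (ψ i) (P.closedPiece i) ∧ EqOn (dφ i) (dψ i) (P.closedPiece i)) ∧
    Differentiable ℂ P.Xi ∧
    -- the numbers `μₙ⁰` are the zeros of `Ξ₀`, counted with multiplicity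
    (∀ z : ℂ, analyticOrderAt P.Xi₀ z = {k | (muZero k : ℂ) = z}.encard) ∧
    -- the zeros of `Ξ`, counted with multiplicity, are numbers `μₙ` with the asymptotics
    ∃ μ : ℤˣ × ℕ → ℂ,
      (∀ z : ℂ, analyticOrderAt P.Xi z = {k | μ k = z}.encard) ∧
      range μ = {z | P.IsSpectral z} ∧
      (fun k => μ k - ((muZero k - 1 / (muZero k * π) *
          (P.β₁p / P.β₂p - P.α₁p / P.α₂p
            + P.Uplus (muZero k) + P.Vplus (muZero k)) : ℝ) : ℂ))
        =O[cofinite] fun k => 1 / (muZero k) ^ 2 := by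
  refine ⟨P.exists_isPhi, fun μ φ dφ ψ dψ hφ hψ => hφ.isSolution.eqOn hψ.isSolution
    (by rw [hφ.initial, hψ.initial]) (by rw [hφ.initial_deriv, hψ.initial_deriv]),
    P.differentiable_Xi,
    P.analyticOrderAt_Xi₀, ?_⟩
  obtain ⟨μ, hμ, hasymp⟩ := P.exists_enumeration_Xi
  refine ⟨μ, hμ, ?_, hasymp⟩
  ext z
  rw [mem_ofPred_eq, P.isSpectral_iff, ← (P.differentiable_Xi.analyticAt z).analyticOrderAt_ne_zero,
    hμ, Ne, encard_eq_zero, ← Ne, ← nonempty_iff_ne_empty]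
  rfl
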